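/- Semi-bandit game. Let $d,m,T$ be integers with $d,m\ge 1$, $T\ge 0$, and let $\mathcal A$ be a nonempty family of subsets of $[d]$, each of size $m$ (the combinatorial actions). A random loss sequence $\ell=(\ell_1,\dots,\ell_T)$, with $\ell_t\in[0,1]^d$ almost surely, is drawn from an arbitrary prior known to the player. In round $t$ the player plays a random $a_t\in\mathcal A$, pays $\langle \ell_t,a_t\rangle=\sum_{i\in a_t}\ell_t(i)$ and observes $X_t=(\ell_t(i)\mathbf 1_{i\in a_t})_{i\in[d]}$. Let $a^*=a^*(\ell)\in\arg\min_{a\in\mathcal A}\sum_{t}\langle\ell_t,a\rangle$ (ties broken by any measurable rule), let $L^*=\sum_t\langle \ell_t,a^*\rangle$, let $R_T=\sum_{t}\langle\ell_t,a_t\rangle-L^*$, and let $p_t(\cdot)=\mathbb P_t[a^*=\cdot]$ be the posterior law of $a^*$ given $a_1,X_1,\dots,a_{t-1},X_{t-1}$. Thompson Sampling thresholded at $\gamma$ is the following strategy. In round $t$, start with $\mathcal R_t=\emptyset$ and, as long as there is $i\notin\mathcal R_t$ with $\mathbb P_t[i\in a^*\text{ and }\mathcal R_t\cap a^*=\emptyset]\le\gamma$,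 add such an $i$ to $\mathcal R_t$. Then, independently of $\ell$ given the past actions and observations, play $a_t=a$ with probability $$\hat p_t(a)=\frac{p_t(a)}{1-\sum_{a'\in\mathcal A:\,a'\cap\mathcal R_t\ne\emptyset}p_t(a')}\ \text{ if } a\cap\mathcal R_t=\emptyset,\qquad \hat p_t(a)=0\ \text{ otherwise.}$$ Theorem. There is an absolute constant $C>0$ such that the following holds for all $d,m,T$, all $\mathcal A$, all priors as above and all real $\underline L^*\ge 2$. Suppose that $L^*\le\underline L^*$ almost surely and that $$\gamma=\frac{m\log^2(\underline L^*)}{\underline L^*}\le\frac1{2d}.$$ Then Thompson Sampling for semi-bandit feedback, thresholded at $\gamma$, satisfies $$\mathbb E[R_T]\le C\left((1+\log m)\sqrt{d\,\underline L^*}+m d\log^2(\underline L^*)\right).$$ In particular the bound does not depend on $T$, and for $m\ge2$ it is $O\left(\log(m)\sqrt{d\underline L^*}+md\log^2(\underline L^*)\right)$. -/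

import Mathlib

open MeasureTheory ProbabilityTheory

noncomputable section

namespace SemiBandit

/-- The total loss `∑ₜ ⟨ℓₜ, a⟩` of a fixed set of arms `a` under the loss sequence `ℓ`. -/
def totalLoss {T d : ℕ} (ℓ : Fin T → Fin d → ℝ) (a : Finset (Fin d)) : ℝ :=
  ∑ t, ∑ i ∈ a, ℓ t i

/-- The loss `L*` of the best fixed combinatorial action. -/
def bestLoss {T d : ℕ} (A : Finset (Finset (Fin d))) (hA : A.Nonempty)
    (ℓ : Fin T → Fin d → ℝ) : ℝ :=
  A.inf' hA (totalLoss ℓ)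

/-- `astar` picks, measurably in the loss sequence, an optimal action `a*`
(ties are broken arbitrarily). -/
structure IsOptimalAction {T d : ℕ} (A : Finset (Finset (Fin d)))
    (astar : (Fin T → Fin d → ℝ) → Finset (Fin d)) : Prop where
  measurable : Measurable astar
  mem : ∀ ℓ, astar ℓ ∈ A
  le : ∀ ℓ, ∀ b ∈ A, totalLoss ℓ (astar ℓ) ≤ totalLoss ℓ b

/-- For `p` the law of `a*` on the action set `A`, the probability that `i ∈ a*` and that
`a*` contains no arm of `R`. -/
def cleanProb {d : ℕ} (A : Finset (Finset (Fin d))) (p : Finset (Fin d) → ℝ)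
    (R : Finset (Fin d)) (i : Fin d) : ℝ :=
  ∑ a ∈ A with i ∈ a ∧ Disjoint a R, p a

/-- The arms outside `R` that may be added to the set `R` of rare arms. -/
def rareCandidates {d : ℕ} (A : Finset (Finset (Fin d))) (p : Finset (Fin d) → ℝ) (γ : ℝ)
    (R : Finset (Fin d)) : Finset (Fin d) :=
  Finset.univ.filter fun i => i ∉ R ∧ cleanProb A p R i ≤ γ

/-- One step of the procedure: add one arm to `R` if there is a candidate, else stop. -/
def growRare {d : ℕ} (A : Finset (Finset (Fin d))) (p : Finset (Fin d) → ℝ) (γ : ℝ)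
    (R : Finset (Fin d)) : Finset (Fin d) :=
  if h : (rareCandidates A p γ R).Nonempty then
    insert ((rareCandidates A p γ R).min' h) R
  else R

/-- The set of rare arms: starting from `∅`, as long as there is an arm `i` outside `R` with
`P(i ∈ a* and R ∩ a* = ∅) ≤ γ`, add it to `R`. As there are `d` arms, the procedure has stopped
after `d` steps; for `p ≥ 0` its result does not depend on which candidate is added first. -/
def rareArms {d : ℕ} (A : Finset (Finset (Fin d))) (p : Finset (Fin d) → ℝ) (γ : ℝ) :
    Finset (Fin d) :=
  (growRare A p γ)^[d] ∅

/-- The distribution from which thresholded Thompson Sampling plays when the posterior law of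
`a*` is `p`: condition `p` on the actions that contain no rare arm. -/
def thresholdedLaw {d : ℕ} (A : Finset (Finset (Fin d))) (p : Finset (Fin d) → ℝ) (γ : ℝ)
    (a : Finset (Fin d)) : ℝ :=
  if Disjoint a (rareArms A p γ) then
    p a / (1 - ∑ b ∈ A with ¬ Disjoint b (rareArms A p γ), p b)
  else 0

/-- The semi-bandit feedback `ℓₜ ⊙ aₜ`. -/
def feedback {d : ℕ} (x : Fin d → ℝ) (a : Finset (Fin d)) : Fin d → ℝ :=
  fun i => if i ∈ a then x i else 0

variable {Ω : Type*} [mΩ : MeasurableSpace Ω] {T d : ℕ}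

/-- The player's information at the beginning of round `t`: the σ-algebra generated by
`a₁, X₁, …, aₜ₋₁, Xₜ₋₁` with `Xₛ = ℓₛ ⊙ aₛ`. -/
abbrev playerInfo (ℓ : Ω → Fin T → Fin d → ℝ) (act : Fin T → Ω → Finset (Fin d)) (t : Fin T) :
    MeasurableSpace Ω :=
  ⨆ s : {s : Fin T // s < t},
    MeasurableSpace.comap (fun ω => (act s ω, feedback (ℓ ω s) (act s ω))) inferInstance

/-- The σ-algebra generated by the whole loss sequence and by the actions played before
round `t`. -/
abbrev fullInfo (ℓ : Ω → Fin T → Fin d → ℝ) (act : Fin T → Ω → Finset (Fin d)) (t : Fin T) :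
    MeasurableSpace Ω :=
  MeasurableSpace.comap ℓ inferInstance ⊔
    ⨆ s : {s : Fin T // s < t}, MeasurableSpace.comap (act s) inferInstance

/-- The posterior law `pₜ` of `a*` at the beginning of round `t`. -/
def posterior (P : Measure Ω) (ℓ : Ω → Fin T → Fin d → ℝ)
    (astar : (Fin T → Fin d → ℝ) → Finset (Fin d)) (act : Fin T → Ω → Finset (Fin d))
    (t : Fin T) (ω : Ω) (a : Finset (Fin d)) : ℝ :=
  (P⟦{ω' | astar (ℓ ω') = a} | playerInfo ℓ act t⟧) ω

/-- The actions `act` are those of Thompson Sampling for semi-bandit feedback, thresholded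
at `γ`, for the prior `P.map ℓ`: in round `t`, given all losses and all earlier actions, `aₜ` is
drawn from the thresholded posterior. The distribution depends on what the player has observed
only; conditioning on all losses says that the player's randomness is independent of them. -/
structure IsThresholdedThompsonSampling (P : Measure Ω) (A : Finset (Finset (Fin d))) (γ : ℝ)
    (ℓ : Ω → Fin T → Fin d → ℝ) (astar : (Fin T → Fin d → ℝ) → Finset (Fin d))
    (act : Fin T → Ω → Finset (Fin d)) : Prop where
  measurable_act : ∀ t, Measurable (act t)
  law_act : ∀ t a, P⟦{ω | act t ω = a} | fullInfo ℓ act t⟧ =ᵐ[P]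
    fun ω => thresholdedLaw A (posterior P ℓ astar act t ω) γ a

/-- The expected regret `E[R_T] = E[∑ₜ ⟨ℓₜ, aₜ⟩ - L*]`. -/
def expectedRegret (P : Measure Ω) (A : Finset (Finset (Fin d))) (hA : A.Nonempty)
    (ℓ : Ω → Fin T → Fin d → ℝ) (act : Fin T → Ω → Finset (Fin d)) : ℝ :=
  ∫ ω, (∑ t, ∑ i ∈ act t ω, ℓ ω t i - bestLoss A hA (ℓ ω)) ∂P

end SemiBandit

end

open MeasureTheory ProbabilityTheory

noncomputable section

namespace SemiBandit

/-! ### Bounded functions and conditional expectations. -/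

section Helpers

variable {Ω : Type*} {m m0 : MeasurableSpace Ω} {P : Measure Ω}

/-! The regret is analysed arm by arm. Let `x` be the loss of an arm in a round, `π` the conditional
probability that it is played, and `N` the indicator that it is not rare. Each arm made rare costs
posterior mass at most `γ`, so the actions discarded by thresholding have mass at most `γ * d ≤
1/2`. Hence the regret is at most `γ * d` times the player's expected loss `S`, plus a sum over arms
and rounds of `N * (clean posterior of the arm - indicator of the arm being optimal) * x`
(`arm_regret_le`). The indicator is split further according to the dyadic size `L / 2^k` of the
arm's own cumulative loss. Since the losses of the arms in `a*` add up to at most `L`, bin `k`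
contains at most `2^(k+1)` of them, and about `log m` bins suffice (`sum_integral_binInd_le`).

Fix an arm and a bin with indicator `s`, and let `q` be the posterior mean of `s`. Two facts carry
the proof.

Information: the potential `E √(q + ε)` decreases in each round by at least a constant times `π √(q
+ ε) e² / x̄`, where `x̄` is the posterior mean loss and `e` measures how far conditioning on `s`
lowers it (`integral_gain_le`). Bounding the square root by well-chosen linear majorants proves this
without entropy. The total decrease is at most `√(P(s) + ε)`. By Young's inequality the regret on
`s` is then at most this decrease plus a multiple of `ρ c x̄ + x̄ / ρ`, where `c ≤ π` is the clean
part of `q` (`regret_le_gain`, `sum_integral_regret_le`). The terms `c x̄` sum to at most the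
player's loss.

Self-limitation: the terms `x̄` matter only while the arm is not rare and `q ≥ ε`, and they sum to
`O(L / 2^k)` in expectation (`sum_integral_likely_le`). Indeed the importance-weighted loss estimate
has increments at most `1/γ` by thresholding, so an exponential supermartingale compares it with
twice the true loss. If the estimate, which the player can compute, is far above `L / 2^k`, then `s`
has become implausible, except with a probability that the choice of `γ` makes negligible.

Optimising the parameters and summing over arms by Cauchy-Schwarz, each bin costs `O(√(d L))` plus a
small multiple of `√(d / L) * S` (`bin_regret_le`). Since `S ≤ R + L` and `m * d = O(L)`, the terms
in `R` on the right are absorbed (`regret_bound_of_recursion`). -/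

lemma integrable_of_abs_le [IsFiniteMeasure P] {f : Ω → ℝ} (hf : Measurable f) {C : ℝ}
    (h : ∀ ω, |f ω| ≤ C) : Integrable f P :=
  Integrable.of_bound hf.aestronglyMeasurable C (ae_of_all _ h)

lemma integrable_of_ae_abs_le [IsFiniteMeasure P] {f : Ω → ℝ} (hf : Measurable f) {C : ℝ}
    (h : ∀ᵐ ω ∂P, |f ω| ≤ C) : Integrable f P :=
  Integrable.of_bound hf.aestronglyMeasurable C h

/-- A bounded `m`-measurable factor may be moved inside a conditional expectation. -/
lemma integral_mul_condExp [IsFiniteMeasure P] (hm : m ≤ m0) {f g : Ω → ℝ}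
    (hf : Measurable[m] f) (hg : Integrable g P) {C : ℝ} (h : ∀ᵐ ω ∂P, |f ω| ≤ C) :
    ∫ ω, f ω * (P[g | m]) ω ∂P = ∫ ω, f ω * g ω ∂P := by
  have h1 := condExp_stronglyMeasurable_mul_of_bound hm hf.stronglyMeasurable hg C h
  calc ∫ ω, f ω * (P[g | m]) ω ∂P = ∫ ω, (P[f * g | m]) ω ∂P :=
        integral_congr_ae (h1.mono fun ω hω => by rw [hω]; rfl)
    _ = ∫ ω, f ω * g ω ∂P := by rw [integral_condExp hm]; rfl

lemma condExp_mem_Icc [IsFiniteMeasure P] (hm : m ≤ m0) {g : Ω → ℝ} (hg : Measurable g)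
    (h0 : ∀ ω, 0 ≤ g ω) (h1 : ∀ ω, g ω ≤ 1) :
    ∀ᵐ ω ∂P, 0 ≤ (P[g | m]) ω ∧ (P[g | m]) ω ≤ 1 := by
  have hi : Integrable g P :=
    integrable_of_abs_le hg (C := 1) fun ω => abs_le.2 ⟨by linarith [h0 ω], h1 ω⟩
  have ha : 0 ≤ᵐ[P] P[g | m] := condExp_nonneg (ae_of_all _ h0)
  have hb : P[g | m] ≤ᵐ[P] P[(fun _ => (1 : ℝ)) | m] :=
    condExp_mono hi (integrable_const _) (ae_of_all _ h1)
  rw [condExp_const hm] at hb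
  filter_upwards [ha, hb] with ω h2 h3 using ⟨h2, h3⟩

lemma measurable_condExp_self {g : Ω → ℝ} : Measurable[m] (P[g | m]) :=
  stronglyMeasurable_condExp.measurable

end Helpers

/-! ### Importance-weighted loss estimates of one arm and their exponential moment. -/

/-- The data attached to a single arm: its losses `x n`, the indicator `I n` that it is played,
the conditional probability `π n` that it is played, and the indicator `N n` that it is not rare.
The player's information is `F n`; `G n` contains moreover the losses. -/
structure ArmProcess {Ω : Type*} [m0 : MeasurableSpace Ω] (P : Measure Ω) (γ : ℝ) where
  F : ℕ → MeasurableSpace Ω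
  G : ℕ → MeasurableSpace Ω
  x : ℕ → Ω → ℝ
  I : ℕ → Ω → ℝ
  π : ℕ → Ω → ℝ
  N : ℕ → Ω → ℝ
  F_mono : Monotone F
  G_mono : Monotone G
  F_le_G : ∀ n, F n ≤ G n
  G_le : ∀ n, G n ≤ m0
  x_meas : ∀ n, Measurable[G 0] (x n)
  x_nonneg : ∀ n ω, 0 ≤ x n ω
  x_le : ∀ n ω, x n ω ≤ 1
  I_meas : ∀ n, Measurable[G (n + 1)] (I n)
  I_eq : ∀ n ω, I n ω = 0 ∨ I n ω = 1
  obs_meas : ∀ n, Measurable[F (n + 1)] fun ω => I n ω * x n ω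
  π_meas : ∀ n, Measurable[F n] (π n)
  π_nonneg : ∀ n ω, 0 ≤ π n ω
  π_le : ∀ n ω, π n ω ≤ 1
  N_meas : ∀ n, Measurable[F n] (N n)
  N_eq : ∀ n ω, N n ω = 0 ∨ N n ω = 1
  le_π : ∀ n ω, N n ω = 1 → γ ≤ π n ω
  law : ∀ n, P[I n | G n] =ᵐ[P] π n

namespace ArmProcess

variable {Ω : Type*} [m0 : MeasurableSpace Ω] {P : Measure Ω} {γ : ℝ}
  (X : ArmProcess P γ)

lemma F_le (n : ℕ) : X.F n ≤ m0 := (X.F_le_G n).trans (X.G_le n)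

lemma N_nonneg (n : ℕ) (ω : Ω) : 0 ≤ X.N n ω := by rcases X.N_eq n ω with h | h <;> simp [h]

lemma N_le (n : ℕ) (ω : Ω) : X.N n ω ≤ 1 := by rcases X.N_eq n ω with h | h <;> simp [h]

lemma I_nonneg (n : ℕ) (ω : Ω) : 0 ≤ X.I n ω := by rcases X.I_eq n ω with h | h <;> simp [h]

lemma I_le (n : ℕ) (ω : Ω) : X.I n ω ≤ 1 := by rcases X.I_eq n ω with h | h <;> simp [h]

lemma x_meas_G (n k : ℕ) : Measurable[X.G k] (X.x n) :=
  (X.x_meas n).mono (X.G_mono (Nat.zero_le k)) le_rfl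

lemma x_meas' (n : ℕ) : Measurable (X.x n) := (X.x_meas n).mono (X.G_le 0) le_rfl

lemma I_meas' (n : ℕ) : Measurable (X.I n) := (X.I_meas n).mono (X.G_le _) le_rfl

lemma π_meas' (n : ℕ) : Measurable (X.π n) := (X.π_meas n).mono (X.F_le _) le_rfl

lemma N_meas' (n : ℕ) : Measurable (X.N n) := (X.N_meas n).mono (X.F_le _) le_rfl

/-- Averaging over the player's randomness. -/
lemma integral_mul_I [IsFiniteMeasure P] (n : ℕ) {f : Ω → ℝ} (hf : Measurable[X.G n] f) {C : ℝ}
    (h : ∀ᵐ ω ∂P, |f ω| ≤ C) :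
    ∫ ω, f ω * X.I n ω ∂P = ∫ ω, f ω * X.π n ω ∂P := by
  have hI : Integrable (X.I n) P := integrable_of_abs_le (X.I_meas' n) (C := 1) fun ω => by
    rw [abs_of_nonneg (X.I_nonneg n ω)]; exact X.I_le n ω
  rw [← integral_mul_condExp (X.G_le n) hf hI h]
  exact integral_congr_ae ((X.law n).mono fun ω hω => by simp only [hω])

/-- The importance weighted estimate of the loss in a round in which the arm is not rare. -/
def est (n : ℕ) (ω : Ω) : ℝ := X.N n ω * X.x n ω / X.π n ω * X.I n ω

/-- The estimated cumulative loss. -/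
def cum (n : ℕ) (ω : Ω) : ℝ := ∑ s ∈ Finset.range n, X.est s ω

lemma est_nonneg (n : ℕ) (ω : Ω) : 0 ≤ X.est n ω :=
  mul_nonneg (div_nonneg (mul_nonneg (X.N_nonneg n ω) (X.x_nonneg n ω)) (X.π_nonneg n ω))
    (X.I_nonneg n ω)

lemma weight_nonneg (n : ℕ) (ω : Ω) : 0 ≤ X.N n ω * X.x n ω / X.π n ω :=
  div_nonneg (mul_nonneg (X.N_nonneg n ω) (X.x_nonneg n ω)) (X.π_nonneg n ω)

lemma weight_le (hγ : 0 < γ) (n : ℕ) (ω : Ω) : X.N n ω * X.x n ω / X.π n ω ≤ 1 / γ := by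
  rcases X.N_eq n ω with h | h
  · rw [h]; simp; positivity
  · have := X.le_π n ω h
    rw [h, one_mul]
    exact div_le_div₀ zero_le_one (X.x_le n ω) hγ this

lemma est_le (hγ : 0 < γ) (n : ℕ) (ω : Ω) : X.est n ω ≤ 1 / γ := by
  have h := X.weight_le hγ n ω
  have h0 := X.weight_nonneg n ω
  unfold est
  calc _ ≤ X.N n ω * X.x n ω / X.π n ω * 1 := by gcongr; exact X.I_le n ω
    _ ≤ _ := by linarith

/-- This is the unbiasedness of `est`: where `N = 1` the threshold keeps `π` away from zero, and
elsewhere both sides vanish. -/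
lemma weight_mul_π (hγ : 0 < γ) (n : ℕ) (ω : Ω) :
    X.N n ω * X.x n ω / X.π n ω * X.π n ω = X.N n ω * X.x n ω := by
  rcases X.N_eq n ω with h | h
  · simp [h]
  · have := hγ.trans_le (X.le_π n ω h)
    rw [div_mul_cancel₀ _ this.ne']

lemma weight_meas (n : ℕ) : Measurable[X.G n] fun ω => X.N n ω * X.x n ω / X.π n ω :=
  (((X.N_meas n).mono (X.F_le_G n) le_rfl).mul (X.x_meas_G n n)).div
    ((X.π_meas n).mono (X.F_le_G n) le_rfl)

lemma est_meas (n : ℕ) : Measurable[X.G (n + 1)] (X.est n) :=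
  ((X.weight_meas n).mono (X.G_mono n.le_succ) le_rfl).mul (X.I_meas n)

lemma est_eq (n : ℕ) : X.est n = fun ω => X.N n ω / X.π n ω * (X.I n ω * X.x n ω) := by
  funext ω; unfold est; ring

/-- The loss enters the estimate only through `I * x`, which the player observes. So the estimate
belongs to the player's information although `x` need not. -/
lemma est_meas_F (n : ℕ) : Measurable[X.F (n + 1)] (X.est n) := by
  rw [X.est_eq n]
  exact (((X.N_meas n).mono (X.F_mono n.le_succ) le_rfl).div
    ((X.π_meas n).mono (X.F_mono n.le_succ) le_rfl)).mul (X.obs_meas n)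

lemma cum_meas_F (n : ℕ) : Measurable[X.F n] (X.cum n) := by
  unfold cum
  refine Finset.measurable_fun_sum _ fun s hs => ?_
  exact (X.est_meas_F s).mono (X.F_mono (Finset.mem_range.1 hs)) le_rfl

lemma cum_meas (n : ℕ) : Measurable (X.cum n) := (X.cum_meas_F n).mono (X.F_le n) le_rfl

lemma cum_meas_G (n : ℕ) : Measurable[X.G n] (X.cum n) :=
  (X.cum_meas_F n).mono (X.F_le_G n) le_rfl

lemma cum_le (hγ : 0 < γ) (n : ℕ) (ω : Ω) : X.cum n ω ≤ n * (1 / γ) := by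
  unfold cum
  calc _ ≤ ∑ _s ∈ Finset.range n, 1 / γ := Finset.sum_le_sum fun s _ => X.est_le hγ s ω
    _ = _ := by simp

lemma cum_mono (ω : Ω) : Monotone fun n => X.cum n ω := by
  refine monotone_nat_of_le_succ fun n => ?_
  simp only [cum, Finset.sum_range_succ]
  linarith [X.est_nonneg n ω]

lemma loss_meas (n : ℕ) : Measurable[X.G 0] fun ω => ∑ s ∈ Finset.range n, X.x s ω :=
  Finset.measurable_fun_sum _ fun s _ => X.x_meas s

/-- The chord of the convex exponential over `[0, 1]` has slope `e - 1 ≤ 2`. -/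
lemma exp_le_one_add_two_mul {y : ℝ} (h0 : 0 ≤ y) (h1 : y ≤ 1) : Real.exp y ≤ 1 + 2 * y := by
  have := convexOn_exp.2 (Set.mem_univ 0) (Set.mem_univ 1) (sub_nonneg.2 h1) h0 (by ring)
  simp only [smul_eq_mul, mul_zero, mul_one, zero_add, Real.exp_zero] at this
  nlinarith [Real.exp_one_lt_d9]

/-- The exponential moment of the estimated cumulative loss is controlled by the true loss. -/
lemma integral_exp_cum_le [IsProbabilityMeasure P] (hγ : 0 < γ) {s : Ω → ℝ}
    (hs : Measurable[X.G 0] s)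
    (hs0 : ∀ ω, 0 ≤ s ω) (hs1 : ∀ ω, s ω ≤ 1) (n : ℕ) :
    ∫ ω, s ω * Real.exp (γ * X.cum n ω - 2 * γ * ∑ k ∈ Finset.range n, X.x k ω) ∂P
      ≤ 1 := by
  have hmeasW : ∀ n, Measurable[X.G n] fun ω =>
      s ω * Real.exp (γ * X.cum n ω - 2 * γ * ∑ k ∈ Finset.range n, X.x k ω) := fun n =>
    (hs.mono (X.G_mono (Nat.zero_le _)) le_rfl).mul (Real.measurable_exp.comp
      (((X.cum_meas_G n).const_mul γ).sub
        (((X.loss_meas n).mono (X.G_mono (Nat.zero_le _)) le_rfl).const_mul (2 * γ))))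
  have hbd : ∀ n ω, |s ω * Real.exp (γ * X.cum n ω - 2 * γ * ∑ k ∈ Finset.range n, X.x k ω)|
      ≤ Real.exp n := by
    intro n ω
    have h1 := X.cum_le hγ n ω
    have h2 : 0 ≤ ∑ k ∈ Finset.range n, X.x k ω := Finset.sum_nonneg fun k _ => X.x_nonneg k ω
    rw [abs_of_nonneg (mul_nonneg (hs0 ω) (Real.exp_pos _).le)]
    have h3 : γ * X.cum n ω ≤ n := by
      calc _ ≤ γ * (n * (1 / γ)) := by gcongr
        _ = n := by field_simp
    calc _ ≤ 1 * Real.exp n := by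
          gcongr
          · exact hs1 ω
          · nlinarith
      _ = _ := one_mul _
  induction n with
  | zero =>
    calc _ ≤ ∫ _ω, (1 : ℝ) ∂P := by
          refine integral_mono (integrable_of_abs_le ((hmeasW 0).mono (X.G_le 0) le_rfl) (hbd 0))
            (integrable_const _) fun ω => ?_
          simp [cum, hs1 ω]
      _ = 1 := by simp
  | succ n ih =>
    refine le_trans ?_ ih
    set W : Ω → ℝ := fun ω =>
      s ω * Real.exp (γ * X.cum n ω - 2 * γ * ∑ k ∈ Finset.range n, X.x k ω) with hW
    -- `V` already contains the compensator of round `n`. It is `G n`-measurable because all losses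
    -- are, so only the player's draw remains to be averaged.
    set V : Ω → ℝ := fun ω => W ω * Real.exp (-(2 * γ * X.x n ω)) with hV
    have hW0 : ∀ ω, 0 ≤ W ω := fun ω => mul_nonneg (hs0 ω) (Real.exp_pos _).le
    have hV0 : ∀ ω, 0 ≤ V ω := fun ω => mul_nonneg (hW0 ω) (Real.exp_pos _).le
    have hVW : ∀ ω, V ω ≤ W ω := fun ω => by
      have : Real.exp (-(2 * γ * X.x n ω)) ≤ 1 := Real.exp_le_one_iff.2 (by
        have := X.x_nonneg n ω; nlinarith [mul_nonneg hγ.le this])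
      exact mul_le_of_le_one_right (hW0 ω) this
    have hVm : Measurable[X.G n] V := (hmeasW n).mul (Real.measurable_exp.comp
      (((X.x_meas_G n n).const_mul (2 * γ)).neg))
    have hVb : ∀ ω, V ω ≤ Real.exp n := fun ω =>
      (hVW ω).trans ((le_abs_self _).trans (hbd n ω))
    set w : Ω → ℝ := fun ω => X.N n ω * X.x n ω / X.π n ω with hw
    have hfm : Measurable[X.G n] fun ω => V ω * (2 * γ * w ω) :=
      hVm.mul ((X.weight_meas n).const_mul (2 * γ))
    have hfb : ∀ ω, |V ω * (2 * γ * w ω)| ≤ Real.exp n * 2 := fun ω => by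
      have h1 := X.weight_nonneg n ω
      have h2 : γ * w ω ≤ 1 := by
        calc _ ≤ γ * (1 / γ) := by gcongr; exact X.weight_le hγ n ω
          _ = 1 := by field_simp
      have h3 : 0 ≤ γ * w ω := mul_nonneg hγ.le h1
      rw [abs_of_nonneg (mul_nonneg (hV0 ω) (by linarith))]
      exact mul_le_mul (hVb ω) (by linarith) (by linarith) (Real.exp_pos _).le
    have hVi : Integrable V P := integrable_of_abs_le (hVm.mono (X.G_le n) le_rfl) fun ω => by
      rw [abs_of_nonneg (hV0 ω)]; exact hVb ω
    have hfI : Integrable (fun ω => V ω * (2 * γ * w ω) * X.I n ω) P :=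
      integrable_of_abs_le ((hfm.mono (X.G_le n) le_rfl).mul (X.I_meas' n)) fun ω => by
        rw [abs_mul, abs_of_nonneg (X.I_nonneg n ω)]
        exact (mul_le_of_le_one_right (abs_nonneg _) (X.I_le n ω)).trans (hfb ω)
    have hfπ : Integrable (fun ω => V ω * (2 * γ * w ω) * X.π n ω) P :=
      integrable_of_abs_le ((hfm.mono (X.G_le n) le_rfl).mul (X.π_meas' n)) fun ω => by
        rw [abs_mul, abs_of_nonneg (X.π_nonneg n ω)]
        exact (mul_le_of_le_one_right (abs_nonneg _) (X.π_le n ω)).trans (hfb ω)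
    -- Supermartingale step: bound `exp (γ * est)` by `1 + 2 * γ * est`, average over the draw so
    -- that `I` becomes `π`, and absorb `1 + 2 * γ * x` into the factor `exp (2 * γ * x)` that
    -- separates `W` from `V`.
    calc ∫ ω, s ω * Real.exp (γ * X.cum (n + 1) ω
            - 2 * γ * ∑ k ∈ Finset.range (n + 1), X.x k ω) ∂P
        ≤ ∫ ω, (V ω + V ω * (2 * γ * w ω) * X.I n ω) ∂P := by
          refine integral_mono
            (integrable_of_abs_le ((hmeasW (n + 1)).mono (X.G_le _) le_rfl) (hbd (n + 1)))
            (hVi.add hfI) fun ω => ?_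
          have h1 : γ * X.est n ω ≤ 1 := by
            calc _ ≤ γ * (1 / γ) := by gcongr; exact X.est_le hγ n ω
              _ = 1 := by field_simp
          have h2 := exp_le_one_add_two_mul (mul_nonneg hγ.le (X.est_nonneg n ω)) h1
          have h3 : s ω * Real.exp (γ * X.cum (n + 1) ω
              - 2 * γ * ∑ k ∈ Finset.range (n + 1), X.x k ω)
              = V ω * Real.exp (γ * X.est n ω) := by
            simp only [hV, hW, cum, Finset.sum_range_succ]
            rw [mul_assoc (s ω), mul_assoc (s ω), ← Real.exp_add, ← Real.exp_add]
            ring_nf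
          have h4 := mul_le_mul_of_nonneg_left h2 (hV0 ω)
          have h5 : V ω * (2 * γ * w ω) * X.I n ω = V ω * (2 * (γ * X.est n ω)) := by
            simp only [hw, est]; ring
          simp only
          rw [h3, h5]; linarith
      _ = ∫ ω, (V ω + V ω * (2 * γ * w ω) * X.π n ω) ∂P := by
          rw [integral_add hVi hfI, integral_add hVi hfπ,
            X.integral_mul_I n hfm (ae_of_all _ hfb)]
      _ ≤ ∫ ω, W ω ∂P := by
          refine integral_mono (hVi.add hfπ)
            (integrable_of_abs_le ((hmeasW n).mono (X.G_le n) le_rfl) (hbd n)) fun ω => ?_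
          have h1 : V ω * (2 * γ * w ω) * X.π n ω = V ω * (2 * γ * (X.N n ω * X.x n ω)) := by
            rw [← X.weight_mul_π hγ n ω]; ring
          have h2 : X.N n ω * X.x n ω ≤ X.x n ω :=
            mul_le_of_le_one_left (X.x_nonneg n ω) (X.N_le n ω)
          have h3 : 1 + 2 * γ * X.x n ω ≤ Real.exp (2 * γ * X.x n ω) := by
            linarith [Real.add_one_le_exp (2 * γ * X.x n ω)]
          have h4 : V ω * Real.exp (2 * γ * X.x n ω) = W ω := by
            simp only [hV]; rw [mul_assoc, ← Real.exp_add]; simp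
          simp only
          rw [h1, ← h4]
          have h5 : V ω * (2 * γ * (X.N n ω * X.x n ω)) ≤ V ω * (2 * γ * X.x n ω) := by
            have := hV0 ω
            gcongr
          nlinarith [mul_le_mul_of_nonneg_left h3 (hV0 ω)]

end ArmProcess

/-! ### A large estimate makes the event `s` implausible. -/

namespace ArmProcess

variable {Ω : Type*} [m0 : MeasurableSpace Ω] {P : Measure Ω} {γ : ℝ}
  (X : ArmProcess P γ)

/-- Some round before `T` in which the posterior probability is at least `ε` although the estimated
cumulative loss has reached `z`. -/
def exceed (s : Ω → ℝ) (ε z : ℝ) (T : ℕ) : Set Ω :=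
  {ω | ∃ t < T, ε ≤ (P[s | X.F t]) ω ∧ z ≤ X.cum t ω}

lemma exceed_succ (s : Ω → ℝ) (ε z : ℝ) (T : ℕ) :
    X.exceed s ε z (T + 1) =
      X.exceed s ε z T ∪ {ω | ε ≤ (P[s | X.F T]) ω ∧ z ≤ X.cum T ω} := by
  ext ω
  simp only [exceed, Set.mem_ofPred_eq, Set.mem_union, Nat.lt_succ_iff_lt_or_eq]
  constructor
  · rintro ⟨t, h | rfl, h2⟩
    · exact Or.inl ⟨t, h, h2⟩
    · exact Or.inr h2
  · rintro (⟨t, h, h2⟩ | h)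
    · exact ⟨t, Or.inl h, h2⟩
    · exact ⟨T, Or.inr rfl, h⟩

lemma measurableSet_exceed (s : Ω → ℝ) (ε z : ℝ) (T : ℕ) :
    MeasurableSet[X.F T] (X.exceed s ε z T) := by
  have h : X.exceed s ε z T =
      ⋃ t : {t : ℕ // t < T}, {ω | ε ≤ (P[s | X.F t]) ω ∧ z ≤ X.cum t ω} := by
    ext ω; simp only [exceed, Set.mem_ofPred_eq, Set.mem_iUnion, Subtype.exists, exists_prop]
  rw [h]
  refine MeasurableSet.iUnion fun t => ?_
  refine X.F_mono t.2.le _ ?_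
  exact (measurableSet_le measurable_const measurable_condExp_self).inter
    (measurableSet_le measurable_const (X.cum_meas_F t))

lemma integrable_weight [IsFiniteMeasure P] {s : Ω → ℝ} (hs : Measurable[X.G 0] s)
    (hs0 : ∀ ω, 0 ≤ s ω) (hs1 : ∀ ω, s ω ≤ 1) : Integrable s P :=
  integrable_of_abs_le (hs.mono (X.G_le 0) le_rfl) (C := 1) fun ω => by
    rw [abs_of_nonneg (hs0 ω)]; exact hs1 ω

/-- Optional stopping: decompose according to the first round in which both conditions hold. Each
piece is known to the player in that round, so on it the posterior mean, which is at least `ε`, has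
the same integral as `s`. -/
lemma mul_measure_exceed_le [IsProbabilityMeasure P] {s : Ω → ℝ} (hs : Measurable[X.G 0] s)
    (hs0 : ∀ ω, 0 ≤ s ω) (hs1 : ∀ ω, s ω ≤ 1) (ε z : ℝ) (T : ℕ) :
    ε * P.real (X.exceed s ε z T) ≤ ∫ ω in X.exceed s ε z T, s ω ∂P := by
  have hsi := X.integrable_weight hs hs0 hs1
  induction T with
  | zero => simp [exceed]
  | succ T ih =>
    set A : Set Ω := {ω | ε ≤ (P[s | X.F T]) ω ∧ z ≤ X.cum T ω} with hA
    set U := X.exceed s ε z T with hU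
    have hUm : MeasurableSet[X.F T] U := X.measurableSet_exceed s ε z T
    have hAm : MeasurableSet[X.F T] A :=
      (measurableSet_le measurable_const measurable_condExp_self).inter
        (measurableSet_le measurable_const (X.cum_meas_F T))
    have hD : MeasurableSet[X.F T] (A \ U) := hAm.diff hUm
    have hDm := X.F_le T _ hD
    have hdisj : Disjoint U (A \ U) := Set.disjoint_sdiff_right
    rw [X.exceed_succ, ← Set.union_sdiff_self, measureReal_union hdisj hDm,
      setIntegral_union hdisj hDm hsi.integrableOn hsi.integrableOn, mul_add]
    refine add_le_add ih ?_
    rw [← setIntegral_condExp (X.F_le T) hsi hD]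
    calc ε * P.real (A \ U) = ∫ _ω in A \ U, ε ∂P := by
          rw [setIntegral_const, smul_eq_mul, mul_comm]
      _ ≤ _ := setIntegral_mono_on (integrable_const _).integrableOn
          integrable_condExp.integrableOn hDm fun ω hω => hω.1.1

/-- Exponential Markov inequality under the weight `s`: where `s ≠ 0` the true loss is at most `B`,
and the estimate, being monotone in time, still exceeds `z` at time `T`. The factor `1 / ε` passes
from the weight `s` back to the probability. -/
lemma measure_exceed_le [IsProbabilityMeasure P] (hγ : 0 < γ) {s : Ω → ℝ}
    (hs : Measurable[X.G 0] s) (hs0 : ∀ ω, 0 ≤ s ω) (hs1 : ∀ ω, s ω ≤ 1) {ε : ℝ} (hε : 0 < ε)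
    {B : ℝ} (z : ℝ) (T : ℕ)
    (hB : ∀ᵐ ω ∂P, s ω ≠ 0 → ∑ k ∈ Finset.range T, X.x k ω ≤ B) :
    P.real (X.exceed s ε z T) ≤ Real.exp (2 * γ * B - γ * z) / ε := by
  rw [le_div_iff₀ hε, mul_comm]
  refine (X.mul_measure_exceed_le hs hs0 hs1 ε z T).trans ?_
  have hUm := X.F_le T _ (X.measurableSet_exceed s ε z T)
  have hWm : Measurable fun ω =>
      s ω * Real.exp (γ * X.cum T ω - 2 * γ * ∑ k ∈ Finset.range T, X.x k ω) :=
    (hs.mono (X.G_le 0) le_rfl).mul (Real.measurable_exp.comp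
      (((X.cum_meas T).const_mul γ).sub
        (((X.loss_meas T).mono (X.G_le 0) le_rfl).const_mul (2 * γ))))
  have hWi : Integrable (fun ω =>
      s ω * Real.exp (γ * X.cum T ω - 2 * γ * ∑ k ∈ Finset.range T, X.x k ω)) P := by
    refine integrable_of_abs_le hWm (C := Real.exp T) fun ω => ?_
    have h2 : 0 ≤ ∑ k ∈ Finset.range T, X.x k ω := Finset.sum_nonneg fun k _ => X.x_nonneg k ω
    rw [abs_of_nonneg (mul_nonneg (hs0 ω) (Real.exp_pos _).le)]
    have h3 : γ * X.cum T ω ≤ T := by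
      calc _ ≤ γ * (T * (1 / γ)) := by gcongr; exact X.cum_le hγ T ω
        _ = T := by field_simp
    calc _ ≤ 1 * Real.exp T := by
          gcongr
          · exact hs1 ω
          · nlinarith
      _ = _ := one_mul _
  rw [← integral_indicator hUm]
  calc ∫ ω, (X.exceed s ε z T).indicator s ω ∂P
      ≤ ∫ ω, Real.exp (2 * γ * B - γ * z) *
          (s ω * Real.exp (γ * X.cum T ω - 2 * γ * ∑ k ∈ Finset.range T, X.x k ω)) ∂P := by
        refine integral_mono_ae ((X.integrable_weight hs hs0 hs1).indicator hUm)
          (hWi.const_mul _) ?_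
        filter_upwards [hB] with ω hω
        by_cases hU : ω ∈ X.exceed s ε z T
        · rw [Set.indicator_of_mem hU]
          by_cases h0 : s ω = 0
          · simp [h0]
          obtain ⟨t, ht, -, hz⟩ := hU
          have h1 : z ≤ X.cum T ω := hz.trans (X.cum_mono ω ht.le)
          have h2 := hω h0
          rw [mul_left_comm, ← Real.exp_add]
          refine le_mul_of_one_le_right (hs0 ω) (Real.one_le_exp ?_)
          nlinarith [mul_le_mul_of_nonneg_left h1 hγ.le, mul_le_mul_of_nonneg_left h2 hγ.le]
        · rw [Set.indicator_of_notMem hU]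
          exact mul_nonneg (Real.exp_pos _).le (mul_nonneg (hs0 ω) (Real.exp_pos _).le)
    _ ≤ Real.exp (2 * γ * B - γ * z) * 1 := by
        rw [integral_const_mul]
        exact mul_le_mul_of_nonneg_left (X.integral_exp_cum_le hγ hs hs0 hs1 T)
          (Real.exp_pos _).le
    _ = _ := mul_one _

/-- The indicator that the posterior mean of `s` is at least `ε`. -/
def likely (s : Ω → ℝ) (ε : ℝ) (n : ℕ) (ω : Ω) : ℝ :=
  {ω | ε ≤ (P[s | X.F n]) ω}.indicator (fun _ => 1) ω

lemma likely_meas (s : Ω → ℝ) (ε : ℝ) (n : ℕ) : Measurable[X.F n] (X.likely s ε n) :=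
  Measurable.indicator measurable_const
    (measurableSet_le measurable_const measurable_condExp_self)

lemma likely_eq (s : Ω → ℝ) (ε : ℝ) (n : ℕ) (ω : Ω) :
    (ε ≤ (P[s | X.F n]) ω ∧ X.likely s ε n ω = 1) ∨
      ((P[s | X.F n]) ω < ε ∧ X.likely s ε n ω = 0) := by
  by_cases h : ε ≤ (P[s | X.F n]) ω
  · exact Or.inl ⟨h, Set.indicator_of_mem (s := {ω | ε ≤ (P[s | X.F n]) ω}) h _⟩
  · exact Or.inr ⟨not_le.1 h, Set.indicator_of_notMem (s := {ω | ε ≤ (P[s | X.F n]) ω}) h _⟩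

lemma likely_nonneg (s : Ω → ℝ) (ε : ℝ) (n : ℕ) (ω : Ω) : 0 ≤ X.likely s ε n ω := by
  rcases X.likely_eq s ε n ω with ⟨-, h⟩ | ⟨-, h⟩ <;> simp [h]

lemma likely_le (s : Ω → ℝ) (ε : ℝ) (n : ℕ) (ω : Ω) : X.likely s ε n ω ≤ 1 := by
  rcases X.likely_eq s ε n ω with ⟨-, h⟩ | ⟨-, h⟩ <;> simp [h]

/-- Take for `t` the last round with posterior mean at least `ε`. Earlier rounds contribute at most
`cum t`, and round `t` itself at most `1 / γ`. -/
lemma sum_est_mul_likely_le_cum (hγ : 0 < γ) (s : Ω → ℝ) (ε : ℝ) (ω : Ω) (T : ℕ) :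
    ∑ n ∈ Finset.range T, X.est n ω * X.likely s ε n ω = 0 ∨
      ∃ t < T, ε ≤ (P[s | X.F t]) ω ∧
        ∑ n ∈ Finset.range T, X.est n ω * X.likely s ε n ω ≤ X.cum t ω + 1 / γ := by
  induction T with
  | zero => simp
  | succ T ih =>
    rw [Finset.sum_range_succ]
    rcases X.likely_eq s ε T ω with ⟨h, h1⟩ | ⟨h, h1⟩
    · refine Or.inr ⟨T, Nat.lt_succ_self T, h, ?_⟩
      rw [h1, mul_one]
      refine add_le_add (Finset.sum_le_sum fun n _ => ?_) (X.est_le hγ T ω)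
      exact mul_le_of_le_one_right (X.est_nonneg n ω) (X.likely_le s ε n ω)
    · rw [h1, mul_zero, add_zero]
      rcases ih with h2 | ⟨t, ht, h2⟩
      · exact Or.inl h2
      · exact Or.inr ⟨t, ht.trans (Nat.lt_succ_self T), h2⟩

/-- A layer-cake bound with step `1 / γ`: the overshoot of the estimate above `z` is counted by the
levels `z + j / γ` that it passes. `T` levels suffice because each round adds at most `1 / γ`. -/
lemma sum_est_mul_likely_le (hγ : 0 < γ) (s : Ω → ℝ) (ε : ℝ) {z : ℝ} (hz : 0 ≤ z) (ω : Ω)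
    (T : ℕ) :
    ∑ n ∈ Finset.range T, X.est n ω * X.likely s ε n ω ≤
      z + 1 / γ + 1 / γ * ∑ j ∈ Finset.range T,
        (X.exceed s ε (z + j / γ) T).indicator (fun _ => (1 : ℝ)) ω := by
  have hγ' : 0 < 1 / γ := by positivity
  have hI : ∀ j, 0 ≤ (X.exceed s ε (z + (j : ℕ) / γ) T).indicator (fun _ => (1 : ℝ)) ω :=
    fun j => Set.indicator_nonneg (fun _ _ => zero_le_one) _
  have hnn : 0 ≤ 1 / γ * ∑ j ∈ Finset.range T,
      (X.exceed s ε (z + j / γ) T).indicator (fun _ => (1 : ℝ)) ω :=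
    mul_nonneg hγ'.le (Finset.sum_nonneg fun j _ => hI j)
  rcases X.sum_est_mul_likely_le_cum hγ s ε ω T with h | ⟨t, ht, hq, h⟩
  · rw [h]; linarith
  refine h.trans ?_
  by_cases hc : X.cum t ω ≤ z
  · linarith
  push Not at hc
  set J := ⌈γ * (X.cum t ω - z)⌉₊ with hJ
  have hJT : J ≤ T := by
    refine Nat.ceil_le.2 ?_
    have h1 := X.cum_le hγ t ω
    have h2 : (t : ℝ) ≤ T := by exact_mod_cast ht.le
    calc γ * (X.cum t ω - z) ≤ γ * (t * (1 / γ)) := by gcongr; linarith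
      _ = t := by field_simp
      _ ≤ T := h2
  have hsum : (J : ℝ) ≤ ∑ j ∈ Finset.range T,
      (X.exceed s ε (z + j / γ) T).indicator (fun _ => (1 : ℝ)) ω := by
    calc (J : ℝ) = ∑ _j ∈ Finset.range J, (1 : ℝ) := by simp
      _ ≤ ∑ j ∈ Finset.range J,
          (X.exceed s ε (z + j / γ) T).indicator (fun _ => (1 : ℝ)) ω := by
          refine Finset.sum_le_sum fun j hj => ?_
          rw [Set.indicator_of_mem]
          refine ⟨t, ht, hq, ?_⟩
          have h3 := Nat.lt_ceil.1 (Finset.mem_range.1 hj)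
          have h4 : (j : ℝ) / γ < X.cum t ω - z := by rw [div_lt_iff₀ hγ]; linarith
          linarith
      _ ≤ _ := Finset.sum_le_sum_of_subset_of_nonneg (Finset.range_subset_range.2 hJT)
          fun j _ _ => hI j
  have h5 : γ * (X.cum t ω - z) ≤ ∑ j ∈ Finset.range T,
      (X.exceed s ε (z + j / γ) T).indicator (fun _ => (1 : ℝ)) ω := (Nat.le_ceil _).trans hsum
  have h6 := mul_le_mul_of_nonneg_left h5 hγ'.le
  have h7 : 1 / γ * (γ * (X.cum t ω - z)) = X.cum t ω - z := by field_simp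
  linarith

/-- The loss of an arm that is not rare, in the rounds in which the posterior probability that
its cumulative loss is at most `B` is not negligible. -/
lemma sum_integral_likely_le [IsProbabilityMeasure P] (hγ : 0 < γ) {s : Ω → ℝ}
    (hs : Measurable[X.G 0] s) (hs0 : ∀ ω, 0 ≤ s ω) (hs1 : ∀ ω, s ω ≤ 1) {ε : ℝ} (hε : 0 < ε)
    {B : ℝ} (hB0 : 0 ≤ B) (T : ℕ)
    (hB : ∀ᵐ ω ∂P, s ω ≠ 0 → ∑ k ∈ Finset.range T, X.x k ω ≤ B) :
    ∑ n ∈ Finset.range T, ∫ ω, X.N n ω * X.x n ω * X.likely s ε n ω ∂P ≤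
      3 * B + 1 / γ + 2 * (Real.exp (-(γ * B)) / (ε * γ)) := by
  have hLm : ∀ n, Measurable (X.likely s ε n) := fun n =>
    (X.likely_meas s ε n).mono (X.F_le n) le_rfl
  have hEm : ∀ n, Measurable (X.est n) := fun n => (X.est_meas n).mono (X.G_le _) le_rfl
  have hint : ∀ n, Integrable (fun ω => X.est n ω * X.likely s ε n ω) P := fun n =>
    integrable_of_abs_le ((hEm n).mul (hLm n)) (C := 1 / γ) fun ω => by
      rw [abs_of_nonneg (mul_nonneg (X.est_nonneg n ω) (X.likely_nonneg s ε n ω))]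
      exact (mul_le_of_le_one_right (X.est_nonneg n ω) (X.likely_le s ε n ω)).trans
        (X.est_le hγ n ω)
  have heq : ∀ n, ∫ ω, X.N n ω * X.x n ω * X.likely s ε n ω ∂P =
      ∫ ω, X.est n ω * X.likely s ε n ω ∂P := by
    intro n
    have h := X.integral_mul_I n (f := fun ω => X.N n ω * X.x n ω / X.π n ω * X.likely s ε n ω)
      ((X.weight_meas n).mul ((X.likely_meas s ε n).mono (X.F_le_G n) le_rfl)) (C := 1 / γ)
      (ae_of_all _ fun ω => by
        rw [abs_of_nonneg (mul_nonneg (X.weight_nonneg n ω) (X.likely_nonneg s ε n ω))]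
        exact (mul_le_of_le_one_right (X.weight_nonneg n ω) (X.likely_le s ε n ω)).trans
          (X.weight_le hγ n ω))
    calc _ = ∫ ω, X.N n ω * X.x n ω / X.π n ω * X.likely s ε n ω * X.π n ω ∂P := by
          refine integral_congr_ae (ae_of_all _ fun ω => ?_)
          simp only
          rw [mul_right_comm (X.N n ω * X.x n ω / X.π n ω), X.weight_mul_π hγ n ω]
      _ = _ := by
          rw [← h]
          refine integral_congr_ae (ae_of_all _ fun ω => ?_)
          simp only [est]; ring
  have hUm : ∀ z, MeasurableSet (X.exceed s ε z T) := fun z =>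
    X.F_le T _ (X.measurableSet_exceed s ε z T)
  have hIi : ∀ z, Integrable ((X.exceed s ε z T).indicator fun _ => (1 : ℝ)) P := fun z =>
    (integrable_const _).indicator (hUm z)
  rw [Finset.sum_congr rfl fun n _ => heq n, ← integral_finsetSum _ fun n _ => hint n]
  -- The base level `3 * B` leaves the exponent `2γB - γ(3B + j/γ) = -γB - j`: a small prefactor
  -- times a series with ratio `1/e ≤ 1/2`.
  calc ∫ ω, ∑ n ∈ Finset.range T, X.est n ω * X.likely s ε n ω ∂P
      ≤ ∫ ω, (3 * B + 1 / γ + 1 / γ * ∑ j ∈ Finset.range T,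
        (X.exceed s ε (3 * B + j / γ) T).indicator (fun _ => (1 : ℝ)) ω) ∂P := by
        refine integral_mono (integrable_finsetSum _ fun n _ => hint n)
          ((integrable_const _).add
            ((integrable_finsetSum _ fun j _ => hIi _).const_mul _)) fun ω => ?_
        exact X.sum_est_mul_likely_le hγ s ε (by positivity) ω T
    _ = 3 * B + 1 / γ + 1 / γ * ∑ j ∈ Finset.range T, P.real (X.exceed s ε (3 * B + j / γ) T) := by
        rw [integral_add (integrable_const _)
          ((integrable_finsetSum _ fun j _ => hIi _).const_mul _), integral_const_mul,
          integral_finsetSum _ fun j _ => hIi _]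
        simp [hUm, integral_indicator_const]
    _ ≤ 3 * B + 1 / γ + 1 / γ * ∑ j ∈ Finset.range T,
          Real.exp (-(γ * B)) / ε * (1 / 2) ^ j := by
        gcongr with j hj
        refine (X.measure_exceed_le hγ hs hs0 hs1 hε _ T hB).trans ?_
        rw [div_mul_eq_mul_div]
        gcongr
        have h1 : 2 * γ * B - γ * (3 * B + j / γ) = -(γ * B) + (j : ℝ) * (-1) := by
          field_simp; ring
        rw [h1, Real.exp_add, Real.exp_nat_mul]
        gcongr
        rw [Real.exp_neg, one_div]
        exact inv_anti₀ (by norm_num) (by linarith [Real.add_one_le_exp (1 : ℝ)])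
    _ ≤ _ := by
        rw [← Finset.mul_sum]
        have h1 := sum_geometric_two_le T
        have h2 : 0 ≤ Real.exp (-(γ * B)) / ε := by positivity
        have h3 : 2 * (Real.exp (-(γ * B)) / (ε * γ)) = 1 / γ * (Real.exp (-(γ * B)) / ε * 2) := by
          field_simp
        rw [h3]
        gcongr

/-- The total loss of an arm in the rounds in which it is not rare. -/
lemma sum_integral_N_le [IsProbabilityMeasure P] (hγ : 0 < γ) {s : Ω → ℝ}
    (hs : Measurable[X.G 0] s) (hs0 : ∀ ω, 0 ≤ s ω) (hs1 : ∀ ω, s ω ≤ 1) {ε : ℝ} (hε : 0 < ε)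
    {B : ℝ} (hB0 : 0 ≤ B) (T : ℕ)
    (hB : ∀ᵐ ω ∂P, s ω ≠ 0 → ∑ k ∈ Finset.range T, X.x k ω ≤ B)
    (hN : ∀ n, ∀ᵐ ω ∂P, X.N n ω = 1 → ε ≤ (P[s | X.F n]) ω) :
    ∑ n ∈ Finset.range T, ∫ ω, X.N n ω * X.x n ω ∂P ≤
      3 * B + 1 / γ + 2 * (Real.exp (-(γ * B)) / (ε * γ)) := by
  refine le_trans (le_of_eq (Finset.sum_congr rfl fun n _ => ?_))
    (X.sum_integral_likely_le hγ hs hs0 hs1 hε hB0 T hB)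
  refine integral_congr_ae ((hN n).mono fun ω hω => ?_)
  rcases X.N_eq n ω with h | h
  · simp [h]
  · rcases X.likely_eq s ε n ω with ⟨-, h1⟩ | ⟨h1, -⟩
    · simp [h1]
    · exact absurd (hω h) (not_le.2 h1)

end ArmProcess

lemma integral_add_three {Ω : Type*} [MeasurableSpace Ω] {P : Measure Ω} {f g h : Ω → ℝ}
    (hf : Integrable f P) (hg : Integrable g P) (hh : Integrable h P) :
    ∫ ω, (f ω + g ω + h ω) ∂P = ∫ ω, f ω ∂P + ∫ ω, g ω ∂P + ∫ ω, h ω ∂P := by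
  have hfg : Integrable (fun ω => f ω + g ω) P := hf.add hg
  rw [integral_add hfg hh, integral_add hf hg]

/-! ### Scalar inequalities behind the square-root potential. -/

section Scalar

/-- The tangent to the square root at `s²`. It replaces concavity arguments throughout, because a
bound linear in `Z` can be integrated when `Z` is a posterior mean. -/
lemma sqrt_le_half_div_add {Z s : ℝ} (hZ : 0 ≤ Z) (hs : 0 < s) : √Z ≤ (Z / s + s) / 2 := by
  have h1 : Z / s = √Z ^ 2 / s := by rw [Real.sq_sqrt hZ]
  rw [h1]
  have h2 : √Z ^ 2 / s + s - 2 * √Z = (√Z - s) ^ 2 / s := by field_simp; ring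
  have h3 : 0 ≤ (√Z - s) ^ 2 / s := by positivity
  linarith

/-- The trial value `r * (1 - β * Y)` guesses the next square root: an observed loss `Y` should
lower it. The reciprocal of `1 - β * Y` is bounded by an affine function of `Y`, using `Y ≤ 1`, so
the draw will enter linearly. -/
lemma sqrt_le_of_tilt {Z r Y β : ℝ} (hZ : 0 ≤ Z) (hr : 0 < r) (hY0 : 0 ≤ Y) (hY1 : Y ≤ 1)
    (hβ0 : 0 ≤ β) (hβ : β ≤ 1 / 4) :
    √Z ≤ (Z * ((1 + (β + 2 * β ^ 2) * Y) / r) + r * (1 - β * Y)) / 2 := by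
  have hβY : β * Y ≤ 1 / 4 := (mul_le_of_le_one_right hβ0 hY1).trans hβ
  have hβY0 : 0 ≤ β * Y := mul_nonneg hβ0 hY0
  have hu : 0 < 1 - β * Y := by linarith
  have h1 := sqrt_le_half_div_add hZ (mul_pos hr hu)
  have h2 : 1 / (1 - β * Y) ≤ 1 + (β + 2 * β ^ 2) * Y := by
    rw [div_le_iff₀ hu]
    have h3 : (1 + (β + 2 * β ^ 2) * Y) * (1 - β * Y) - 1
        = β ^ 2 * Y * (2 - Y - 2 * (β * Y)) := by ring
    have h4 : 0 ≤ β ^ 2 * Y * (2 - Y - 2 * (β * Y)) :=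
      mul_nonneg (mul_nonneg (sq_nonneg _) hY0) (by linarith)
    linarith
  have h5 : Z / (r * (1 - β * Y)) ≤ Z * ((1 + (β + 2 * β ^ 2) * Y) / r) := by
    calc Z / (r * (1 - β * Y)) = Z * (1 / (1 - β * Y) / r) := by field_simp
      _ ≤ _ := by gcongr
  linarith

/-- The excess of the mean loss over the (smoothed) conditional mean loss. -/
def excess (ε q x v : ℝ) : ℝ := max 0 (q * x - v) / (q + ε)

lemma excess_nonneg {ε q x v : ℝ} (hε : 0 < ε) (hq : 0 ≤ q) : 0 ≤ excess ε q x v :=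
  div_nonneg (le_max_left _ _) (by linarith)

lemma excess_le {ε q x v : ℝ} (hε : 0 < ε) (hq : 0 ≤ q) (hx : 0 ≤ x) (hv : 0 ≤ v) :
    excess ε q x v ≤ x := by
  unfold excess
  rw [div_le_iff₀ (by linarith)]
  exact max_le (by positivity) (by nlinarith)

lemma excess_div_nonneg {ε q x v : ℝ} (hε : 0 < ε) (hq : 0 ≤ q) (hx : 0 ≤ x) :
    0 ≤ excess ε q x v / (4 * x) := div_nonneg (excess_nonneg hε hq) (by linarith)

lemma excess_div_le {ε q x v : ℝ} (hε : 0 < ε) (hq : 0 ≤ q) (hx : 0 ≤ x) (hv : 0 ≤ v) :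
    excess ε q x v / (4 * x) ≤ 1 / 4 := by
  rcases hx.eq_or_lt with rfl | hx'
  · simp
  · rw [div_le_iff₀ (by linarith)]
    linarith [excess_le (x := x) hε hq hx hv]

/-- When the excess `e` is positive, `v + ε x = (q + ε)(x - e)`. Apart from a nonpositive term, the
left side is then `π √(q + ε)` times `2xβ² - eβ`, and `β = e / (4x)` is the minimiser of this
quadratic. -/
lemma tilt_gain {ε q x v π : ℝ} (hε : 0 < ε) (hq : 0 ≤ q) (hx : 0 ≤ x) (hv : 0 ≤ v) (hvx : v ≤ x)
    (hπ : 0 ≤ π) {β : ℝ} (hβ : β = excess ε q x v / (4 * x)) :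
    (β + 2 * β ^ 2) / √(q + ε) * π * v
      + (ε * ((β + 2 * β ^ 2) / √(q + ε)) - √(q + ε) * β) * π * x
      ≤ -(π * √(q + ε) * excess ε q x v ^ 2 / x / 8) := by
  set r := √(q + ε) with hr
  have hr0 : 0 < r := Real.sqrt_pos.2 (by linarith)
  have hr2 : r ^ 2 = q + ε := Real.sq_sqrt (by linarith)
  rcases hx.eq_or_lt with rfl | hx'
  · have : v = 0 := le_antisymm hvx hv
    simp [this]
  rcases le_or_gt (q * x) v with hc | hc
  · have he : excess ε q x v = 0 := by unfold excess; rw [max_eq_left (by linarith)]; simp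
    rw [he] at hβ ⊢
    simp [hβ]
  set e := excess ε q x v with he
  have he0 : 0 ≤ e := excess_nonneg hε hq
  have he' : r ^ 2 * e = q * x - v := by
    rw [he, excess, max_eq_right (by linarith), hr2]
    field_simp
  have hv' : v = r ^ 2 * x - ε * x - r ^ 2 * e := by rw [he', hr2]; ring
  have heβ : e = 4 * x * β := by rw [hβ]; field_simp
  have hβ0 : 0 ≤ β := by rw [hβ]; positivity
  have h1 : (β + 2 * β ^ 2) / r * π * v + (ε * ((β + 2 * β ^ 2) / r) - r * β) * π * x
      = -(π * r * e ^ 2 / x / 8) - 2 * π * r * β ^ 2 * e := by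
    rw [hv', heβ]
    field_simp
    ring
  rw [h1]
  have : 0 ≤ 2 * π * r * β ^ 2 * e := by positivity
  linarith

/-- First `c x - v ≤ c e + ε x`, because `c ≤ q + ε`. Young's inequality with parameter `η` trades
`c e` for the gain and `c² x / (π √(q + ε))`. As `c ≤ π` and `c ≤ q`, the last fraction is at most
`√c x`, and `√c` is split by AM-GM with parameter `ρ`. -/
lemma regret_le_gain {ε q x v π c η ρ : ℝ} (hε : 0 < ε) (hx : 0 ≤ x) (hv : 0 ≤ v)
    (hπ : 0 < π) (hc : 0 ≤ c) (hcπ : c ≤ π) (hcq : c ≤ q) (hεq : ε ≤ q) (hη : 0 < η) (hρ : 0 < ρ) :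
    c * x - v ≤ ε * x + η / 2 * (π * √(q + ε) * excess ε q x v ^ 2 / x)
      + 1 / (4 * η) * (ρ * (c * x) + x / ρ) := by
  have hq : 0 ≤ q := hc.trans hcq
  set r := √(q + ε) with hr
  have hr0 : 0 < r := Real.sqrt_pos.2 (by linarith)
  have hr2 : r ^ 2 = q + ε := Real.sq_sqrt (by linarith)
  set e := excess ε q x v with he
  have he0 : 0 ≤ e := excess_nonneg hε hq
  have he1 : q * x - v ≤ r ^ 2 * e := by
    rw [hr2, he, excess, mul_div_cancel₀ _ (by linarith)]
    exact le_max_right _ _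
  have hcr : c ≤ r ^ 2 := by linarith
  have h1 : c * x - v ≤ c * e + ε * x := by
    have h2 : r ^ 2 * (c * x - v) ≤ r ^ 2 * (c * e + ε * x) := by
      have h3 := mul_le_mul_of_nonneg_left he1 hc
      have h4 := mul_le_mul_of_nonneg_right hcr hv
      have h5 := mul_le_mul_of_nonneg_right hcr (mul_nonneg hε.le hx)
      have h6 : r ^ 2 * (c * x - v) = c * (q * x - v) + c * (ε * x) + c * v - r ^ 2 * v := by
        rw [hr2]; ring
      nlinarith
    exact le_of_mul_le_mul_left h2 (by positivity)
  rcases hx.eq_or_lt with rfl | hx'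
  · have : e = 0 := le_antisymm (excess_le hε hq le_rfl hv) he0
    simp only [this] at h1 ⊢
    simpa using h1
  have hsc : √c ≤ (ρ * c + 1 / ρ) / 2 := by
    have := sqrt_le_half_div_add hc (s := 1 / ρ) (by positivity)
    calc √c ≤ _ := this
      _ = _ := by field_simp
  have hsr : √c ≤ r := Real.sqrt_le_sqrt (by linarith)
  have ha : c ^ 2 ≤ π * r * √c := by
    have h7 : √c * √c = c := Real.mul_self_sqrt hc
    calc c ^ 2 = c * (√c * √c) := by rw [h7]; ring
      _ ≤ π * (r * √c) := by gcongr
      _ = _ := by ring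
  have h8 : c * e ≤ η / 2 * (π * r * e ^ 2 / x) + 1 / (2 * η) * (c ^ 2 / (π * r)) * x := by
    have h9 : η / 2 * (π * r * e ^ 2 / x) + 1 / (2 * η) * (c ^ 2 / (π * r)) * x - c * e
        = (η * π * r * e - c * x) ^ 2 / (2 * η * π * r * x) := by
      field_simp; ring
    have h10 : 0 ≤ (η * π * r * e - c * x) ^ 2 / (2 * η * π * r * x) := by positivity
    linarith
  have h11 : c ^ 2 / (π * r) ≤ (ρ * c + 1 / ρ) / 2 := by
    rw [div_le_iff₀ (by positivity)]
    calc c ^ 2 ≤ π * r * √c := ha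
      _ ≤ π * r * ((ρ * c + 1 / ρ) / 2) := by gcongr
      _ = _ := by ring
  have h12 : 1 / (2 * η) * (c ^ 2 / (π * r)) * x
      ≤ 1 / (2 * η) * ((ρ * c + 1 / ρ) / 2) * x := by gcongr
  have h13 : 1 / (2 * η) * ((ρ * c + 1 / ρ) / 2) * x
      = 1 / (4 * η) * (ρ * (c * x) + x / ρ) := by field_simp; ring
  linarith

end Scalar

/-! ### Decrease of the square-root potential, and the regret of one arm on one event. -/

namespace ArmProcess

variable {Ω : Type*} [m0 : MeasurableSpace Ω] {P : Measure Ω} {γ : ℝ}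
  (X : ArmProcess P γ)

/-- The decrease (up to a constant) of the potential in round `n`. -/
def gain (s : Ω → ℝ) (ε : ℝ) (n : ℕ) (ω : Ω) : ℝ :=
  X.π n ω * √((P[s | X.F n]) ω + ε) *
    excess ε ((P[s | X.F n]) ω) ((P[X.x n | X.F n]) ω) ((P[fun ω => s ω * X.x n ω | X.F n]) ω) ^ 2
      / (P[X.x n | X.F n]) ω

lemma x_integrable [IsFiniteMeasure P] (n : ℕ) : Integrable (X.x n) P :=
  integrable_of_abs_le (X.x_meas' n) (C := 1) fun ω => by
    rw [abs_of_nonneg (X.x_nonneg n ω)]; exact X.x_le n ω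

lemma condExp_bounds [IsProbabilityMeasure P] {s : Ω → ℝ} (hs : Measurable[X.G 0] s)
    (hs0 : ∀ ω, 0 ≤ s ω) (hs1 : ∀ ω, s ω ≤ 1) (n : ℕ) :
    ∀ᵐ ω ∂P, (0 ≤ (P[s | X.F n]) ω ∧ (P[s | X.F n]) ω ≤ 1) ∧
      (0 ≤ (P[X.x n | X.F n]) ω ∧ (P[X.x n | X.F n]) ω ≤ 1) ∧
      0 ≤ (P[fun ω => s ω * X.x n ω | X.F n]) ω ∧
      (P[fun ω => s ω * X.x n ω | X.F n]) ω ≤ (P[X.x n | X.F n]) ω := by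
  have hsm := hs.mono (X.G_le 0) le_rfl
  have h0 : ∀ ω, 0 ≤ s ω * X.x n ω := fun ω => mul_nonneg (hs0 ω) (X.x_nonneg n ω)
  have h1 : ∀ ω, s ω * X.x n ω ≤ X.x n ω := fun ω =>
    mul_le_of_le_one_left (X.x_nonneg n ω) (hs1 ω)
  have hi : Integrable (fun ω => s ω * X.x n ω) P :=
    integrable_of_abs_le (hsm.mul (X.x_meas' n)) (C := 1) fun ω => by
      rw [abs_of_nonneg (h0 ω)]; exact (h1 ω).trans (X.x_le n ω)
  have h2 : P[fun ω => s ω * X.x n ω | X.F n] ≤ᵐ[P] P[X.x n | X.F n] :=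
    condExp_mono hi (X.x_integrable n) (ae_of_all _ h1)
  filter_upwards [condExp_mem_Icc (X.F_le n) hsm hs0 hs1,
    condExp_mem_Icc (X.F_le n) (X.x_meas' n) (X.x_nonneg n) (X.x_le n),
    condExp_mem_Icc (X.F_le n) (hsm.mul (X.x_meas' n)) h0 fun ω => (h1 ω).trans (X.x_le n ω), h2]
    with ω ha hb hc hd using ⟨ha, hb, hc.1, hd⟩

lemma excess_meas (s : Ω → ℝ) (ε : ℝ) (n : ℕ) : Measurable[X.F n] fun ω =>
    excess ε ((P[s | X.F n]) ω) ((P[X.x n | X.F n]) ω)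
      ((P[fun ω => s ω * X.x n ω | X.F n]) ω) := by
  unfold excess
  exact ((measurable_const.max
    ((measurable_condExp_self.mul measurable_condExp_self).sub measurable_condExp_self)).div
      (measurable_condExp_self.add_const _))

lemma sqrt_meas (s : Ω → ℝ) (ε : ℝ) (n : ℕ) :
    Measurable[X.F n] fun ω => √((P[s | X.F n]) ω + ε) :=
  (measurable_condExp_self.add_const _).sqrt

lemma gain_meas (s : Ω → ℝ) (ε : ℝ) (n : ℕ) : Measurable[X.F n] (X.gain s ε n) :=
  (((X.π_meas n).mul (X.sqrt_meas s ε n)).mul ((X.excess_meas s ε n).pow_const 2)).div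
    measurable_condExp_self

variable [IsProbabilityMeasure P]

lemma gain_bounds {s : Ω → ℝ} (hs : Measurable[X.G 0] s)
    (hs0 : ∀ ω, 0 ≤ s ω) (hs1 : ∀ ω, s ω ≤ 1) {ε : ℝ} (hε : 0 < ε) (n : ℕ) :
    ∀ᵐ ω ∂P, 0 ≤ X.gain s ε n ω ∧ X.gain s ε n ω ≤ √(1 + ε) := by
  filter_upwards [X.condExp_bounds hs hs0 hs1 n] with ω ⟨hq, hx, hv, hvx⟩
  unfold gain
  set e := excess ε ((P[s | X.F n]) ω) ((P[X.x n | X.F n]) ω)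
    ((P[fun ω => s ω * X.x n ω | X.F n]) ω) with he
  have he0 : 0 ≤ e := excess_nonneg hε hq.1
  have he1 : e ≤ (P[X.x n | X.F n]) ω := excess_le hε hq.1 hx.1 hv
  have hπ := X.π_nonneg n ω
  refine ⟨div_nonneg (by positivity) hx.1, ?_⟩
  have h1 : e ^ 2 / (P[X.x n | X.F n]) ω ≤ 1 := by
    refine div_le_one_of_le₀ ?_ hx.1
    nlinarith
  calc _ = X.π n ω * √((P[s | X.F n]) ω + ε) * (e ^ 2 / (P[X.x n | X.F n]) ω) := by ring
    _ ≤ 1 * √(1 + ε) * 1 := by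
        have := Real.sqrt_le_sqrt (add_le_add_left hq.2 ε)
        exact mul_le_mul (mul_le_mul (X.π_le n ω) this (Real.sqrt_nonneg _) zero_le_one) h1
          (div_nonneg (sq_nonneg _) hx.1) (by positivity)
    _ = _ := by ring

lemma gain_integrable {s : Ω → ℝ} (hs : Measurable[X.G 0] s)
    (hs0 : ∀ ω, 0 ≤ s ω) (hs1 : ∀ ω, s ω ≤ 1) {ε : ℝ} (hε : 0 < ε) (n : ℕ) :
    Integrable (X.gain s ε n) P :=
  integrable_of_ae_abs_le ((X.gain_meas s ε n).mono (X.F_le n) le_rfl)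
    ((X.gain_bounds hs hs0 hs1 hε n).mono fun ω h => by rw [abs_of_nonneg h.1]; exact h.2)

lemma sqrt_integrable {s : Ω → ℝ} (hs : Measurable[X.G 0] s)
    (hs0 : ∀ ω, 0 ≤ s ω) (hs1 : ∀ ω, s ω ≤ 1) (ε : ℝ) (n : ℕ) :
    Integrable (fun ω => √((P[s | X.F n]) ω + ε)) P :=
  integrable_of_ae_abs_le ((X.sqrt_meas s ε n).mono (X.F_le n) le_rfl) (C := √(1 + ε))
    ((X.condExp_bounds hs hs0 hs1 n).mono fun ω h => by
      rw [abs_of_nonneg (Real.sqrt_nonneg _)]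
      exact Real.sqrt_le_sqrt (by linarith [h.1.2]))

/-- The expected square root potential decreases by at least a multiple of the gain. -/
lemma integral_gain_le {s : Ω → ℝ} (hs : Measurable[X.G 0] s)
    (hs0 : ∀ ω, 0 ≤ s ω) (hs1 : ∀ ω, s ω ≤ 1) {ε : ℝ} (hε : 0 < ε) (n : ℕ) :
    ∫ ω, X.gain s ε n ω ∂P ≤ 16 * (∫ ω, √((P[s | X.F n]) ω + ε) ∂P
      - ∫ ω, √((P[s | X.F (n + 1)]) ω + ε) ∂P) := by
  have hsm := hs.mono (X.G_le 0) le_rfl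
  have hsi := X.integrable_weight hs hs0 hs1
  have hsxi : Integrable (fun ω => s ω * X.x n ω) P :=
    integrable_of_abs_le (hsm.mul (X.x_meas' n)) (C := 1) fun ω => by
      rw [abs_of_nonneg (mul_nonneg (hs0 ω) (X.x_nonneg n ω))]
      exact mul_le_one₀ (hs1 ω) (X.x_nonneg n ω) (X.x_le n ω)
  have hbd := X.condExp_bounds hs hs0 hs1 n
  have hbd' := X.condExp_bounds hs hs0 hs1 (n + 1)
  set q : Ω → ℝ := P[s | X.F n] with hq
  set q' : Ω → ℝ := P[s | X.F (n + 1)] with hq'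
  set xb : Ω → ℝ := P[X.x n | X.F n] with hxb
  set v : Ω → ℝ := P[fun ω => s ω * X.x n ω | X.F n] with hv
  set β : Ω → ℝ := fun ω => excess ε (q ω) (xb ω) (v ω) / (4 * xb ω) with hβ
  set r : Ω → ℝ := fun ω => √(q ω + ε) with hr
  set b : Ω → ℝ := fun ω => β ω + 2 * β ω ^ 2 with hb
  have hβm : Measurable[X.F n] β :=
    (X.excess_meas s ε n).div (measurable_condExp_self.const_mul 4)
  have hrm : Measurable[X.F n] r := X.sqrt_meas s ε n
  have hbm : Measurable[X.F n] b := hβm.add ((hβm.pow_const 2).const_mul 2)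
  have hbrm : Measurable[X.F n] fun ω => b ω / r ω := hbm.div hrm
  have hm0 : ∀ {f : Ω → ℝ}, Measurable[X.F n] f → Measurable f :=
    fun h => h.mono (X.F_le n) le_rfl
  have hmG : ∀ {f : Ω → ℝ}, Measurable[X.F n] f → Measurable[X.G n] f :=
    fun h => h.mono (X.F_le_G n) le_rfl
  have hsG : Measurable[X.G n] s := hs.mono (X.G_mono (Nat.zero_le n)) le_rfl
  have hsε : 0 < √ε := Real.sqrt_pos.2 hε
  have hB : ∀ᵐ ω ∂P, (0 ≤ β ω ∧ β ω ≤ 1 / 4) ∧ (√ε ≤ r ω ∧ r ω ≤ √(1 + ε)) ∧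
      (0 ≤ b ω ∧ b ω ≤ 1) ∧ (0 ≤ b ω / r ω ∧ b ω / r ω ≤ 1 / √ε) := by
    filter_upwards [hbd] with ω ⟨h1, h2, h3, _⟩
    have hβ0 : 0 ≤ β ω := excess_div_nonneg hε h1.1 h2.1
    have hβ1 : β ω ≤ 1 / 4 := excess_div_le hε h1.1 h2.1 h3
    have hr1 : √ε ≤ r ω := Real.sqrt_le_sqrt (by linarith [h1.1])
    have hr2 : r ω ≤ √(1 + ε) := Real.sqrt_le_sqrt (by linarith [h1.2])
    have hb0 : 0 ≤ b ω := by simp only [hb]; positivity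
    have hb1 : b ω ≤ 1 := by simp only [hb]; nlinarith
    refine ⟨⟨hβ0, hβ1⟩, ⟨hr1, hr2⟩, ⟨hb0, hb1⟩, div_nonneg hb0 (hsε.le.trans hr1), ?_⟩
    exact div_le_div₀ zero_le_one hb1 hsε hr1
  set Y : Ω → ℝ := fun ω => X.I n ω * X.x n ω with hY
  have hY0 : ∀ ω, 0 ≤ Y ω := fun ω => mul_nonneg (X.I_nonneg n ω) (X.x_nonneg n ω)
  have hY1 : ∀ ω, Y ω ≤ 1 := fun ω => mul_le_one₀ (X.I_le n ω) (X.x_nonneg n ω) (X.x_le n ω)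
  have hYm : Measurable Y := (X.I_meas' n).mul (X.x_meas' n)
  -- The coefficient of the new posterior mean `q'` in the linear majorant. It uses the loss only
  -- through the observation `Y`, hence is known after round `n`, and so `q'` may be replaced by `s`
  -- under the integral.
  set h : Ω → ℝ := fun ω => (1 + b ω * Y ω) / r ω with hh
  have hhm : Measurable[X.F (n + 1)] h := by
    have hup : ∀ {f : Ω → ℝ}, Measurable[X.F n] f → Measurable[X.F (n + 1)] f :=
      fun h => h.mono (X.F_mono n.le_succ) le_rfl
    exact (measurable_const.add ((hup hbm).mul (X.obs_meas n))).div (hup hrm)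
  have hhb : ∀ᵐ ω ∂P, |h ω| ≤ 2 / √ε := by
    filter_upwards [hB] with ω ⟨_, h2, h3, _⟩
    have h4 : 0 ≤ b ω * Y ω := mul_nonneg h3.1 (hY0 ω)
    have h5 : b ω * Y ω ≤ 1 := mul_le_one₀ h3.2 (hY0 ω) (hY1 ω)
    rw [abs_of_nonneg (div_nonneg (by linarith) (hsε.le.trans h2.1))]
    exact div_le_div₀ zero_le_two (by linarith) hsε h2.1
  -- The coefficient of the draw `I` once `s` is back in place. It depends on losses and past
  -- information only, so averaging turns `I` into `π`.
  set f : Ω → ℝ := fun ω => ((s ω + ε) * (b ω / r ω) - r ω * β ω) * X.x n ω with hf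
  have hfm : Measurable[X.G n] f :=
    (((hsG.add_const ε).mul (hmG hbrm)).sub ((hmG hrm).mul (hmG hβm))).mul (X.x_meas_G n n)
  have hfb : ∀ᵐ ω ∂P, |f ω| ≤ (1 + ε) * (1 / √ε) + √(1 + ε) := by
    filter_upwards [hB] with ω ⟨h1, h2, _, h4⟩
    have h5 : 0 ≤ (s ω + ε) * (b ω / r ω) := mul_nonneg (by linarith [hs0 ω]) h4.1
    have h6 : (s ω + ε) * (b ω / r ω) ≤ (1 + ε) * (1 / √ε) :=
      mul_le_mul (by linarith [hs1 ω]) h4.2 h4.1 (by linarith)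
    have h7 : 0 ≤ r ω * β ω := mul_nonneg (hsε.le.trans h2.1) h1.1
    have h8 : r ω * β ω ≤ √(1 + ε) :=
      (mul_le_of_le_one_right (hsε.le.trans h2.1) (by linarith)).trans h2.2
    rw [hf, abs_mul, abs_of_nonneg (X.x_nonneg n ω)]
    refine (mul_le_of_le_one_right (abs_nonneg _) (X.x_le n ω)).trans ?_
    exact abs_le.2 ⟨by linarith, by linarith⟩
  have i_r : Integrable r P := X.sqrt_integrable hs hs0 hs1 ε n
  have i_sqrt' : Integrable (fun ω => √(q' ω + ε)) P := X.sqrt_integrable hs hs0 hs1 ε (n + 1)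
  have i_h : Integrable h P := integrable_of_ae_abs_le (hhm.mono (X.F_le _) le_rfl) hhb
  have i_sh : Integrable (fun ω => h ω * s ω) P :=
    hsi.bdd_mul (hhm.mono (X.F_le _) le_rfl).aestronglyMeasurable hhb
  have i_qh : Integrable (fun ω => h ω * q' ω) P :=
    integrable_condExp.bdd_mul (hhm.mono (X.F_le _) le_rfl).aestronglyMeasurable hhb
  have i_rβY : Integrable (fun ω => r ω * (1 - β ω * Y ω)) P := by
    refine i_r.mul_bdd (c := 1) (measurable_const.sub ((hm0 hβm).mul hYm)).aestronglyMeasurable ?_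
    filter_upwards [hB] with ω ⟨h1, _⟩
    have h2 : 0 ≤ β ω * Y ω := mul_nonneg h1.1 (hY0 ω)
    have h3 : β ω * Y ω ≤ 1 := mul_le_one₀ (by linarith) (hY0 ω) (hY1 ω)
    rw [Real.norm_eq_abs]
    exact abs_le.2 ⟨by linarith, by linarith⟩
  have i_1r : ∀ᵐ ω ∂P, |1 / r ω| ≤ 1 / √ε := by
    filter_upwards [hB] with ω ⟨_, h2, _⟩
    rw [abs_of_nonneg (one_div_nonneg.2 (hsε.le.trans h2.1))]
    exact one_div_le_one_div_of_le hsε h2.1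
  have m_1r : Measurable[X.F n] fun ω => 1 / r ω := measurable_const.div hrm
  have i_s1r : Integrable (fun ω => 1 / r ω * s ω) P :=
    hsi.bdd_mul (hm0 m_1r).aestronglyMeasurable i_1r
  have i_q1r : Integrable (fun ω => 1 / r ω * q ω) P :=
    integrable_condExp.bdd_mul (hm0 m_1r).aestronglyMeasurable i_1r
  have i_1r' : Integrable (fun ω => 1 / r ω) P := integrable_of_ae_abs_le (hm0 m_1r) i_1r
  have i_fI : Integrable (fun ω => f ω * X.I n ω) P := by
    refine integrable_of_ae_abs_le ((hfm.mono (X.G_le n) le_rfl).mul (X.I_meas' n))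
      (C := (1 + ε) * (1 / √ε) + √(1 + ε)) (hfb.mono fun ω h1 => ?_)
    rw [abs_mul, abs_of_nonneg (X.I_nonneg n ω)]
    exact (mul_le_of_le_one_right (abs_nonneg _) (X.I_le n ω)).trans h1
  -- `f * π = f1 * (s * x) + f2 * x` with `f1`, `f2` known to the player. Conditioning therefore
  -- leaves `v` and `xb`, the form needed by `tilt_gain`.
  set f1 : Ω → ℝ := fun ω => b ω / r ω * X.π n ω with hf1
  set f2 : Ω → ℝ := fun ω => (ε * (b ω / r ω) - r ω * β ω) * X.π n ω with hf2
  have hf1m : Measurable[X.F n] f1 := hbrm.mul (X.π_meas n)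
  have hf2m : Measurable[X.F n] f2 :=
    ((hbrm.const_mul ε).sub (hrm.mul hβm)).mul (X.π_meas n)
  have hf1b : ∀ᵐ ω ∂P, |f1 ω| ≤ 1 / √ε := by
    filter_upwards [hB] with ω ⟨_, _, _, h4⟩
    rw [hf1, abs_of_nonneg (mul_nonneg h4.1 (X.π_nonneg n ω))]
    exact (mul_le_of_le_one_right h4.1 (X.π_le n ω)).trans h4.2
  have hf2b : ∀ᵐ ω ∂P, |f2 ω| ≤ ε * (1 / √ε) + √(1 + ε) := by
    filter_upwards [hB] with ω ⟨h1, h2, _, h4⟩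
    have h5 : 0 ≤ ε * (b ω / r ω) := mul_nonneg hε.le h4.1
    have h6 : ε * (b ω / r ω) ≤ ε * (1 / √ε) := mul_le_mul_of_nonneg_left h4.2 hε.le
    have h7 : 0 ≤ r ω * β ω := mul_nonneg (hsε.le.trans h2.1) h1.1
    have h8 : r ω * β ω ≤ √(1 + ε) :=
      (mul_le_of_le_one_right (hsε.le.trans h2.1) (by linarith)).trans h2.2
    rw [hf2, abs_mul, abs_of_nonneg (X.π_nonneg n ω)]
    refine (mul_le_of_le_one_right (abs_nonneg _) (X.π_le n ω)).trans ?_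
    exact abs_le.2 ⟨by linarith, by linarith⟩
  have i_f1 : Integrable (fun ω => f1 ω * (s ω * X.x n ω)) P :=
    hsxi.bdd_mul (hm0 hf1m).aestronglyMeasurable hf1b
  have i_f2 : Integrable (fun ω => f2 ω * X.x n ω) P :=
    (X.x_integrable n).bdd_mul (hm0 hf2m).aestronglyMeasurable hf2b
  have i_f1v : Integrable (fun ω => f1 ω * v ω) P :=
    integrable_condExp.bdd_mul (hm0 hf1m).aestronglyMeasurable hf1b
  have i_f2x : Integrable (fun ω => f2 ω * xb ω) P :=
    integrable_condExp.bdd_mul (hm0 hf2m).aestronglyMeasurable hf2b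
  -- Together, `e1` to `e6` give `2 E √(q' + ε) ≤ 2 E r - (1/8) E gain`, which is where the factor
  -- 16 comes from.
  have e1 : 2 * ∫ ω, √(q' ω + ε) ∂P ≤
      ∫ ω, (h ω * q' ω + ε * h ω + r ω * (1 - β ω * Y ω)) ∂P := by
    rw [← integral_const_mul]
    refine integral_mono_ae (i_sqrt'.const_mul 2) ((i_qh.add (i_h.const_mul ε)).add i_rβY) ?_
    filter_upwards [hB, hbd'] with ω ⟨h1, h2, _⟩ ⟨h5, _⟩
    have := sqrt_le_of_tilt (Z := q' ω + ε) (by linarith [h5.1]) (hsε.trans_le h2.1) (hY0 ω)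
      (hY1 ω) h1.1 h1.2
    simp only [hh, hb]
    linarith
  have e2 : ∫ ω, (h ω * q' ω + ε * h ω + r ω * (1 - β ω * Y ω)) ∂P =
      ∫ ω, (h ω * s ω + ε * h ω + r ω * (1 - β ω * Y ω)) ∂P := by
    rw [integral_add_three i_qh (i_h.const_mul ε) i_rβY,
      integral_add_three i_sh (i_h.const_mul ε) i_rβY,
      integral_mul_condExp (X.F_le (n + 1)) hhm hsi hhb]
  have e3 : ∫ ω, (h ω * s ω + ε * h ω + r ω * (1 - β ω * Y ω)) ∂P =
      ∫ ω, (1 / r ω * s ω + ε * (1 / r ω) + r ω + f ω * X.I n ω) ∂P := by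
    refine integral_congr_ae (ae_of_all _ fun ω => ?_)
    simp only [hh, hf, hY]
    ring
  have e4 : ∫ ω, (1 / r ω * s ω + ε * (1 / r ω) + r ω + f ω * X.I n ω) ∂P =
      ∫ ω, (1 / r ω * q ω + ε * (1 / r ω) + r ω) ∂P
        + (∫ ω, f1 ω * v ω ∂P + ∫ ω, f2 ω * xb ω ∂P) := by
    have i_sum : Integrable (fun ω => 1 / r ω * s ω + ε * (1 / r ω) + r ω) P :=
      (i_s1r.add (i_1r'.const_mul ε)).add i_r
    rw [integral_add i_sum i_fI, integral_add_three i_s1r (i_1r'.const_mul ε) i_r,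
      integral_add_three i_q1r (i_1r'.const_mul ε) i_r,
      integral_mul_condExp (X.F_le n) m_1r hsi i_1r, X.integral_mul_I n hfm hfb,
      integral_mul_condExp (X.F_le n) hf1m hsxi hf1b,
      integral_mul_condExp (X.F_le n) hf2m (X.x_integrable n) hf2b, ← integral_add i_f1 i_f2]
    congr 1
    refine integral_congr_ae (ae_of_all _ fun ω => ?_)
    simp only [hf, hf1, hf2]
    ring
  have e5 : ∫ ω, (1 / r ω * q ω + ε * (1 / r ω) + r ω) ∂P = 2 * ∫ ω, r ω ∂P := by
    rw [← integral_const_mul]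
    refine integral_congr_ae ?_
    filter_upwards [hB, hbd] with ω ⟨_, h2, _⟩ ⟨h5, _⟩
    have h6 : 0 < r ω := hsε.trans_le h2.1
    have h7 : r ω ^ 2 = q ω + ε := Real.sq_sqrt (by linarith [h5.1])
    have h8 : 1 / r ω * q ω + ε * (1 / r ω) = r ω := by
      field_simp
      linarith
    linarith
  have e6 : ∫ ω, f1 ω * v ω ∂P + ∫ ω, f2 ω * xb ω ∂P ≤ -(1 / 8 * ∫ ω, X.gain s ε n ω ∂P) := by
    rw [← integral_add i_f1v i_f2x, ← integral_const_mul, ← integral_neg]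
    refine integral_mono_ae (i_f1v.add i_f2x)
      ((X.gain_integrable hs hs0 hs1 hε n).const_mul _).neg ?_
    filter_upwards [hbd] with ω ⟨h1, h2, h3, h4⟩
    have := tilt_gain (β := β ω) hε h1.1 h2.1 h3 h4 (X.π_nonneg n ω) rfl
    simp only [hf1, hf2, gain, hb, hr]
    refine this.trans (le_of_eq ?_)
    ring
  have e7 : ∫ ω, r ω ∂P = ∫ ω, √(q ω + ε) ∂P := rfl
  linarith

/-- The decreases telescope and the final potential is nonnegative. The initial one is bounded by
Jensen, in the form of the tangent at `a`. -/
lemma sum_integral_gain_le {s : Ω → ℝ} (hs : Measurable[X.G 0] s)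
    (hs0 : ∀ ω, 0 ≤ s ω) (hs1 : ∀ ω, s ω ≤ 1) {ε : ℝ} (hε : 0 < ε) (T : ℕ) :
    ∑ n ∈ Finset.range T, ∫ ω, X.gain s ε n ω ∂P ≤ 16 * √(∫ ω, s ω ∂P + ε) := by
  have h1 : ∑ n ∈ Finset.range T, ∫ ω, X.gain s ε n ω ∂P ≤
      16 * (∫ ω, √((P[s | X.F 0]) ω + ε) ∂P - ∫ ω, √((P[s | X.F T]) ω + ε) ∂P) := by
    induction T with
    | zero => simp
    | succ T ih =>
      rw [Finset.sum_range_succ]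
      linarith [X.integral_gain_le hs hs0 hs1 hε T]
  have h2 : 0 ≤ ∫ ω, √((P[s | X.F T]) ω + ε) ∂P := integral_nonneg fun ω => Real.sqrt_nonneg _
  have hsi := X.integrable_weight hs hs0 hs1
  have hpos : 0 < ∫ ω, s ω ∂P + ε := by
    have := integral_nonneg (μ := P) (f := s) fun ω => hs0 ω
    linarith
  set a := √(∫ ω, s ω ∂P + ε) with ha
  have ha0 : 0 < a := Real.sqrt_pos.2 hpos
  have ha2 : a ^ 2 = ∫ ω, s ω ∂P + ε := Real.sq_sqrt hpos.le
  have hci : Integrable (P[s | X.F 0]) P := integrable_condExp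
  have h3 : ∫ ω, √((P[s | X.F 0]) ω + ε) ∂P ≤ a := by
    calc ∫ ω, √((P[s | X.F 0]) ω + ε) ∂P
        ≤ ∫ ω, ((P[s | X.F 0]) ω * (1 / (2 * a)) + (ε / (2 * a) + a / 2)) ∂P := by
          refine integral_mono_ae (X.sqrt_integrable hs hs0 hs1 ε 0)
            ((hci.mul_const _).add (integrable_const _)) ?_
          filter_upwards [X.condExp_bounds hs hs0 hs1 0] with ω ⟨h4, _⟩
          refine (sqrt_le_half_div_add (by linarith [h4.1]) ha0).trans (le_of_eq ?_)
          field_simp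
          ring
      _ = a := by
          rw [integral_add (hci.mul_const _) (integrable_const _), integral_mul_const,
            integral_condExp (X.F_le 0)]
          simp only [integral_const, probReal_univ, one_smul]
          field_simp
          linarith
  linarith

/-- The part of the regret that one arm contributes on the event `s`. -/
lemma sum_integral_regret_le (hγ : 0 < γ) {s : Ω → ℝ} (hs : Measurable[X.G 0] s)
    (hs0 : ∀ ω, 0 ≤ s ω) (hs1 : ∀ ω, s ω ≤ 1) {ε : ℝ} (hε : 0 < ε) {η ρ : ℝ} (hη : 0 < η)
    (hρ : 0 < ρ) {c : ℕ → Ω → ℝ} (hcm : ∀ n, Measurable[X.F n] (c n))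
    (hc : ∀ n, ∀ᵐ ω ∂P, 0 ≤ c n ω ∧ c n ω ≤ (P[s | X.F n]) ω ∧
      (X.N n ω = 1 → c n ω ≤ X.π n ω)) (T : ℕ) :
    ∑ n ∈ Finset.range T, ∫ ω, X.N n ω * (c n ω - s ω) * X.x n ω ∂P ≤
      ε * ∑ n ∈ Finset.range T, ∫ ω, X.N n ω * X.x n ω ∂P + 8 * η * √(∫ ω, s ω ∂P + ε)
      + 1 / (4 * η) * (ρ * ∑ n ∈ Finset.range T, ∫ ω, X.π n ω * X.x n ω ∂P
        + (∑ n ∈ Finset.range T, ∫ ω, X.N n ω * X.x n ω * X.likely s ε n ω ∂P) / ρ) := by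
  have key : ∀ n, ∫ ω, X.N n ω * (c n ω - s ω) * X.x n ω ∂P ≤
      ε * ∫ ω, X.N n ω * X.x n ω ∂P + η / 2 * ∫ ω, X.gain s ε n ω ∂P
      + 1 / (4 * η) * (ρ * ∫ ω, X.π n ω * X.x n ω ∂P
        + (∫ ω, X.N n ω * X.x n ω * X.likely s ε n ω ∂P) / ρ) := by
    intro n
    have hsm := hs.mono (X.G_le 0) le_rfl
    have hm0 : ∀ {f : Ω → ℝ}, Measurable[X.F n] f → Measurable f :=
      fun h => h.mono (X.F_le n) le_rfl
    have hsxi : Integrable (fun ω => s ω * X.x n ω) P :=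
      integrable_of_abs_le (hsm.mul (X.x_meas' n)) (C := 1) fun ω => by
        rw [abs_of_nonneg (mul_nonneg (hs0 ω) (X.x_nonneg n ω))]
        exact mul_le_one₀ (hs1 ω) (X.x_nonneg n ω) (X.x_le n ω)
    have hbd := X.condExp_bounds hs hs0 hs1 n
    have hNb : ∀ᵐ ω ∂P, |X.N n ω| ≤ 1 := ae_of_all _ fun ω => by
      rw [abs_of_nonneg (X.N_nonneg n ω)]; exact X.N_le n ω
    have hπb : ∀ᵐ ω ∂P, |X.π n ω| ≤ 1 := ae_of_all _ fun ω => by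
      rw [abs_of_nonneg (X.π_nonneg n ω)]; exact X.π_le n ω
    have hNcm : Measurable[X.F n] fun ω => X.N n ω * c n ω := (X.N_meas n).mul (hcm n)
    have hNcb : ∀ᵐ ω ∂P, |X.N n ω * c n ω| ≤ 1 := by
      filter_upwards [hc n, hbd] with ω ⟨h1, h2, _⟩ ⟨h3, _⟩
      rw [abs_of_nonneg (mul_nonneg (X.N_nonneg n ω) h1)]
      exact mul_le_one₀ (X.N_le n ω) h1 (h2.trans h3.2)
    have hNLm : Measurable[X.F n] fun ω => X.N n ω * X.likely s ε n ω :=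
      (X.N_meas n).mul (X.likely_meas s ε n)
    have hNLb : ∀ᵐ ω ∂P, |X.N n ω * X.likely s ε n ω| ≤ 1 := ae_of_all _ fun ω => by
      rw [abs_of_nonneg (mul_nonneg (X.N_nonneg n ω) (X.likely_nonneg s ε n ω))]
      exact mul_le_one₀ (X.N_le n ω) (X.likely_nonneg s ε n ω) (X.likely_le s ε n ω)
    have hxi := X.x_integrable n
    have hxci : Integrable (P[X.x n | X.F n]) P := integrable_condExp
    have hvci : Integrable (P[fun ω => s ω * X.x n ω | X.F n]) P := integrable_condExp
    have j1 := hxci.bdd_mul (hm0 hNcm).aestronglyMeasurable hNcb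
    have j2 := hvci.bdd_mul (X.N_meas' n).aestronglyMeasurable hNb
    have j3 := hxci.bdd_mul (X.N_meas' n).aestronglyMeasurable hNb
    have j4 := X.gain_integrable hs hs0 hs1 hε n
    have j5 := hxci.bdd_mul (X.π_meas' n).aestronglyMeasurable hπb
    have j6 := hxci.bdd_mul (hm0 hNLm).aestronglyMeasurable hNLb
    have j7 := hxi.bdd_mul (hm0 hNcm).aestronglyMeasurable hNcb
    have j8 := hsxi.bdd_mul (X.N_meas' n).aestronglyMeasurable hNb
    have l1 : ∫ ω, X.N n ω * (c n ω - s ω) * X.x n ω ∂P =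
        ∫ ω, X.N n ω * c n ω * (P[X.x n | X.F n]) ω ∂P
          - ∫ ω, X.N n ω * (P[fun ω => s ω * X.x n ω | X.F n]) ω ∂P := by
      rw [integral_mul_condExp (X.F_le n) hNcm hxi hNcb,
        integral_mul_condExp (X.F_le n) (X.N_meas n) hsxi hNb, ← integral_sub j7 j8]
      refine integral_congr_ae (ae_of_all _ fun ω => ?_)
      simp only
      ring
    have l2 : ∫ ω, X.N n ω * X.x n ω * X.likely s ε n ω ∂P =
        ∫ ω, X.N n ω * X.likely s ε n ω * (P[X.x n | X.F n]) ω ∂P := by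
      rw [integral_mul_condExp (X.F_le n) hNLm hxi hNLb]
      refine integral_congr_ae (ae_of_all _ fun ω => ?_)
      simp only
      ring
    have j9 : Integrable (fun ω => 1 / (4 * η) * (ρ * (X.π n ω * (P[X.x n | X.F n]) ω)
        + X.N n ω * X.likely s ε n ω * (P[X.x n | X.F n]) ω / ρ)) P :=
      ((j5.const_mul _).add (j6.div_const _)).const_mul _
    rw [l1, l2, ← integral_mul_condExp (X.F_le n) (X.N_meas n) hxi hNb,
      ← integral_mul_condExp (X.F_le n) (X.π_meas n) hxi hπb, ← integral_sub j1 j2,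
      ← integral_div, ← integral_const_mul, ← integral_const_mul,
      ← integral_const_mul, ← integral_add (j5.const_mul _) (j6.div_const _), ← integral_const_mul,
      ← integral_add_three (j3.const_mul _) (j4.const_mul _) j9]
    refine integral_mono_ae (j1.sub j2) (((j3.const_mul _).add (j4.const_mul _)).add j9) ?_
    filter_upwards [hbd, hc n, X.gain_bounds hs hs0 hs1 hε n]
      with ω ⟨hq, hx, hv, _⟩ ⟨hc0, hcq, hcπ⟩ ⟨hg, _⟩
    have hL := X.likely_nonneg s ε n ω
    have hπx := mul_nonneg (X.π_nonneg n ω) hx.1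
    have hη' : 0 ≤ 1 / (4 * η) := by positivity
    rcases X.N_eq n ω with hN | hN
    · simp only [hN, zero_mul, mul_zero, sub_zero, zero_add]
      positivity
    · have hcπ := hcπ hN
      have hπ : 0 < X.π n ω := hγ.trans_le (X.le_π n ω hN)
      simp only [hN, one_mul]
      -- `regret_le_gain` is used only where `q ≥ ε`. Otherwise `c ≤ q < ε`, and the round is paid
      -- for by the term `ε * x̄`.
      rcases X.likely_eq s ε n ω with ⟨h1, h2⟩ | ⟨h1, h2⟩
      · have := regret_le_gain hε hx.1 hv hπ hc0 hcπ hcq h1 hη hρ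
        refine this.trans ?_
        rw [h2, one_mul]
        have h3 : c n ω * (P[X.x n | X.F n]) ω ≤ X.π n ω * (P[X.x n | X.F n]) ω :=
          mul_le_mul_of_nonneg_right hcπ hx.1
        unfold gain
        gcongr
      · rw [h2, zero_mul, zero_div, add_zero]
        have h3 : c n ω * (P[X.x n | X.F n]) ω ≤ ε * (P[X.x n | X.F n]) ω :=
          mul_le_mul_of_nonneg_right (by linarith) hx.1
        have h4 : 0 ≤ η / 2 * X.gain s ε n ω := by positivity
        have h5 : 0 ≤ 1 / (4 * η) * (ρ * (X.π n ω * (P[X.x n | X.F n]) ω)) := by positivity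
        linarith
  refine (Finset.sum_le_sum fun n _ => key n).trans ?_
  have hg := X.sum_integral_gain_le hs hs0 hs1 hε T
  have hg2 := mul_le_mul_of_nonneg_left hg (by positivity : 0 ≤ η / 2)
  rw [Finset.sum_add_distrib, Finset.sum_add_distrib, ← Finset.mul_sum, ← Finset.mul_sum,
    ← Finset.mul_sum, Finset.sum_add_distrib, ← Finset.mul_sum, ← Finset.sum_div]
  linarith

end ArmProcess

/-! ### The rare arms and the thresholded law. -/

section Threshold

variable {d : ℕ} {A : Finset (Finset (Fin d))} {p : Finset (Fin d) → ℝ} {γ : ℝ}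

/-- The probability that the optimal action contains an arm of `R`. -/
def dirtyProb (A : Finset (Finset (Fin d))) (p : Finset (Fin d) → ℝ) (R : Finset (Fin d)) : ℝ :=
  ∑ b ∈ A with ¬ Disjoint b R, p b

/-- The probability vectors on the action set. -/
structure IsLaw (A : Finset (Finset (Fin d))) (p : Finset (Fin d) → ℝ) : Prop where
  nonneg : ∀ a, 0 ≤ p a
  sum_eq : ∑ a ∈ A, p a = 1

/-- Every step that does not find the procedure finished adds a new arm. At `n = d` the second
alternative means that all arms are rare. -/
lemma rareArms_growth (A : Finset (Finset (Fin d))) (p : Finset (Fin d) → ℝ) (γ : ℝ) (n : ℕ) :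
    rareCandidates A p γ ((growRare A p γ)^[n] ∅) = ∅ ∨ n ≤ ((growRare A p γ)^[n] ∅).card := by
  induction n with
  | zero => simp
  | succ n ih =>
    rw [Function.iterate_succ_apply']
    set R := (growRare A p γ)^[n] ∅ with hR
    by_cases h : (rareCandidates A p γ R).Nonempty
    · right
      have hg : growRare A p γ R = insert ((rareCandidates A p γ R).min' h) R := by
        unfold growRare; rw [dif_pos h]
      have hn : (rareCandidates A p γ R).min' h ∉ R := by
        have := Finset.min'_mem _ h
        simp only [rareCandidates, Finset.mem_filter] at this
        exact this.2.1
      rw [hg, Finset.card_insert_of_notMem hn]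
      rcases ih with h0 | h0
      · exact absurd h0 h.ne_empty
      · omega
    · left
      have hg : growRare A p γ R = R := by unfold growRare; rw [dif_neg h]
      rw [hg]
      exact Finset.not_nonempty_iff_eq_empty.1 h

lemma lt_cleanProb (A : Finset (Finset (Fin d))) (p : Finset (Fin d) → ℝ) (γ : ℝ) {i : Fin d}
    (hi : i ∉ rareArms A p γ) : γ < cleanProb A p (rareArms A p γ) i := by
  have h0 : rareCandidates A p γ (rareArms A p γ) = ∅ := by
    rcases rareArms_growth A p γ d with h | h
    · exact h
    · have huniv : rareArms A p γ = Finset.univ :=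
        Finset.eq_univ_of_card _ (le_antisymm (Finset.card_le_univ _) ((Fintype.card_fin d).le.trans h))
      exact absurd (huniv ▸ Finset.mem_univ i) hi
  by_contra! hc
  have : i ∈ rareCandidates A p γ (rareArms A p γ) := by
    simp only [rareCandidates, Finset.mem_filter, Finset.mem_univ, true_and]
    exact ⟨hi, hc⟩
  simp [h0] at this

/-- An action that meets `insert i R` but not `R` contains `i` and is counted by `cleanProb`. -/
lemma dirtyProb_insert_le (hp : IsLaw A p) (R : Finset (Fin d)) (i : Fin d) :
    dirtyProb A p (insert i R) ≤ dirtyProb A p R + cleanProb A p R i := by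
  unfold dirtyProb cleanProb
  simp only [Finset.sum_filter]
  rw [← Finset.sum_add_distrib]
  refine Finset.sum_le_sum fun a _ => ?_
  have := hp.nonneg a
  by_cases h1 : Disjoint a R
  · by_cases h2 : i ∈ a
    · split_ifs <;> simp_all
    · have h3 : Disjoint a (insert i R) := Finset.disjoint_insert_right.2 ⟨h2, h1⟩
      simp [h1, h2, h3]
  · split_ifs <;> simp_all

lemma dirtyProb_rareArms_le (hp : IsLaw A p) (hγ : 0 ≤ γ) :
    dirtyProb A p (rareArms A p γ) ≤ γ * d := by
  suffices h : ∀ n : ℕ, dirtyProb A p ((growRare A p γ)^[n] ∅) ≤ γ * n from h d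
  intro n
  induction n with
  | zero => simp [dirtyProb]
  | succ n ih =>
    rw [Function.iterate_succ_apply']
    set R := (growRare A p γ)^[n] ∅
    by_cases h : (rareCandidates A p γ R).Nonempty
    · have hg : growRare A p γ R = insert ((rareCandidates A p γ R).min' h) R := by
        unfold growRare; rw [dif_pos h]
      have hn : cleanProb A p R ((rareCandidates A p γ R).min' h) ≤ γ := by
        have := Finset.min'_mem _ h
        simp only [rareCandidates, Finset.mem_filter] at this
        exact this.2.2
      rw [hg]
      have := dirtyProb_insert_le hp R ((rareCandidates A p γ R).min' h)
      push_cast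
      linarith
    · have hg : growRare A p γ R = R := by unfold growRare; rw [dif_neg h]
      rw [hg]
      push_cast
      linarith

lemma dirtyProb_nonneg (hp : IsLaw A p) (R : Finset (Fin d)) : 0 ≤ dirtyProb A p R :=
  Finset.sum_nonneg fun a _ => hp.nonneg a

lemma cleanProb_nonneg (hp : IsLaw A p) (R : Finset (Fin d)) (i : Fin d) : 0 ≤ cleanProb A p R i :=
  Finset.sum_nonneg fun a _ => hp.nonneg a

lemma cleanProb_le (hp : IsLaw A p) (R : Finset (Fin d)) (i : Fin d) :
    cleanProb A p R i ≤ 1 - dirtyProb A p R := by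
  rw [← hp.sum_eq]
  unfold cleanProb dirtyProb
  rw [← Finset.sum_filter_add_sum_filter_not A (fun a => ¬ Disjoint a R), add_sub_cancel_left]
  refine Finset.sum_le_sum_of_subset_of_nonneg (fun a ha => ?_) fun a _ _ => hp.nonneg a
  simp only [Finset.mem_filter, not_not] at ha ⊢
  exact ⟨ha.1, ha.2.2⟩

lemma cleanProb_of_mem {R : Finset (Fin d)} {i : Fin d} (hi : i ∈ R) : cleanProb A p R i = 0 := by
  unfold cleanProb
  rw [Finset.filter_false_of_mem, Finset.sum_empty]
  rintro a - ⟨h1, h2⟩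
  exact Finset.disjoint_left.1 h2 h1 hi

/-- The probability that thresholded Thompson Sampling plays the arm `i`. -/
def playProb (A : Finset (Finset (Fin d))) (p : Finset (Fin d) → ℝ) (γ : ℝ) (i : Fin d) : ℝ :=
  ∑ a ∈ A with i ∈ a, thresholdedLaw A p γ a

lemma playProb_eq (A : Finset (Finset (Fin d))) (p : Finset (Fin d) → ℝ) (γ : ℝ) (i : Fin d) :
    playProb A p γ i =
      cleanProb A p (rareArms A p γ) i / (1 - dirtyProb A p (rareArms A p γ)) := by
  unfold playProb cleanProb thresholdedLaw dirtyProb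
  rw [Finset.sum_div, ← Finset.sum_filter, Finset.filter_filter]

lemma one_sub_dirtyProb_pos (hp : IsLaw A p) (hγ : 0 < γ) (hγd : γ * d ≤ 1 / 2) :
    0 < 1 - dirtyProb A p (rareArms A p γ) := by
  have := dirtyProb_rareArms_le hp hγ.le
  linarith

lemma playProb_nonneg (hp : IsLaw A p) (hγ : 0 < γ) (hγd : γ * d ≤ 1 / 2)
    (i : Fin d) : 0 ≤ playProb A p γ i := by
  rw [playProb_eq]
  exact div_nonneg (cleanProb_nonneg hp _ i) (one_sub_dirtyProb_pos hp hγ hγd).le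

lemma playProb_le_one (hp : IsLaw A p) (hγ : 0 < γ) (hγd : γ * d ≤ 1 / 2)
    (i : Fin d) : playProb A p γ i ≤ 1 := by
  rw [playProb_eq]
  exact div_le_one_of_le₀ (cleanProb_le hp _ i) (one_sub_dirtyProb_pos hp hγ hγd).le

lemma cleanProb_le_playProb (hp : IsLaw A p) (hγ : 0 < γ) (hγd : γ * d ≤ 1 / 2)
    (i : Fin d) :
    cleanProb A p (rareArms A p γ) i ≤ playProb A p γ i := by
  rw [playProb_eq]
  refine le_div_self (cleanProb_nonneg hp _ i) (one_sub_dirtyProb_pos hp hγ hγd) ?_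
  linarith [dirtyProb_nonneg hp (rareArms A p γ)]

/-- The cost of renormalising is written as a multiple of `playProb` itself, so that it sums to `γ *
d` times the player's loss. -/
lemma playProb_le (hp : IsLaw A p) (hγ : 0 < γ) (hγd : γ * d ≤ 1 / 2)
    (i : Fin d) :
    playProb A p γ i ≤ γ * d * playProb A p γ i + cleanProb A p (rareArms A p γ) i := by
  have h0 := playProb_nonneg hp hγ hγd i
  have h1 : playProb A p γ i * (1 - dirtyProb A p (rareArms A p γ)) =
      cleanProb A p (rareArms A p γ) i := by
    rw [playProb_eq, div_mul_cancel₀ _ (one_sub_dirtyProb_pos hp hγ hγd).ne']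
  have h2 := mul_le_mul_of_nonneg_left (dirtyProb_rareArms_le hp hγ.le) h0
  linarith

end Threshold

/-- The rare set takes finitely many values, so measurability in `p` can be checked with that set
frozen. -/
lemma measurable_comp_of_countable {α β δ : Type*} [MeasurableSpace α] [MeasurableSpace β]
    [MeasurableSpace δ] [Countable β] [MeasurableSingletonClass β] {f : β → α → δ} {R : α → β}
    (hf : ∀ y, Measurable (f y)) (hR : Measurable R) : Measurable fun x => f (R x) x := by
  have h : Measurable fun z : α × β => f z.2 z.1 := measurable_from_prod_countable_left hf
  exact h.comp (measurable_id.prodMk hR)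

section Measurability

variable {d : ℕ} (A : Finset (Finset (Fin d))) (γ : ℝ)

lemma measurable_cleanProb (R : Finset (Fin d)) (i : Fin d) :
    Measurable fun p : Finset (Fin d) → ℝ => cleanProb A p R i :=
  Finset.measurable_fun_sum _ fun a _ => measurable_pi_apply a

lemma measurable_growRare (R : Finset (Fin d)) :
    Measurable fun p : Finset (Fin d) → ℝ => growRare A p γ R := by
  have h1 : Measurable fun p : Finset (Fin d) → ℝ => rareCandidates A p γ R := by
    refine measurable_to_countable' fun S => ?_
    have : (fun p : Finset (Fin d) → ℝ => rareCandidates A p γ R) ⁻¹' {S} =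
        ⋂ i : Fin d, {p | i ∉ R ∧ cleanProb A p R i ≤ γ ↔ i ∈ S} := by
      ext p
      simp [rareCandidates, Finset.ext_iff]
    rw [this]
    refine MeasurableSet.iInter fun i => ?_
    exact ((MeasurableSet.const _).inter
      (measurableSet_le (measurable_cleanProb A R i) measurable_const)).iff (MeasurableSet.const _)
  exact (Measurable.of_discrete (f := fun S : Finset (Fin d) =>
    if h : S.Nonempty then insert (S.min' h) R else R)).comp h1

lemma measurable_rareArms : Measurable fun p : Finset (Fin d) → ℝ => rareArms A p γ := by
  suffices h : ∀ n : ℕ, Measurable fun p : Finset (Fin d) → ℝ => (growRare A p γ)^[n] ∅ from h d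
  intro n
  induction n with
  | zero => exact measurable_const
  | succ n ih =>
    have h1 : (fun p : Finset (Fin d) → ℝ => (growRare A p γ)^[n + 1] ∅) =
        fun p => growRare A p γ ((growRare A p γ)^[n] ∅) :=
      funext fun p => Function.iterate_succ_apply' _ _ _
    rw [h1]
    exact measurable_comp_of_countable (measurable_growRare A γ) ih

lemma measurable_thresholdedLaw (a : Finset (Fin d)) :
    Measurable fun p : Finset (Fin d) → ℝ => thresholdedLaw A p γ a := by
  refine measurable_comp_of_countable (f := fun R (p : Finset (Fin d) → ℝ) =>
    if Disjoint a R then p a / (1 - ∑ b ∈ A with ¬ Disjoint b R, p b) else 0) (fun R => ?_)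
    (measurable_rareArms A γ)
  by_cases h : Disjoint a R
  · simp only [h, if_true]
    exact (measurable_pi_apply a).div (measurable_const.sub
      (Finset.measurable_fun_sum _ fun b _ => measurable_pi_apply b))
  · simp only [h, if_false]
    exact measurable_const

lemma measurable_playProb (i : Fin d) :
    Measurable fun p : Finset (Fin d) → ℝ => playProb A p γ i :=
  Finset.measurable_fun_sum _ fun a _ => measurable_thresholdedLaw A γ a

open Classical in
/-- Replace a vector that is not a probability vector by a point mass. -/
def regularize (a₀ : Finset (Fin d)) (p : Finset (Fin d) → ℝ) : Finset (Fin d) → ℝ :=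
  if IsLaw A p then p else Pi.single a₀ 1

lemma regularize_of_isLaw {a₀ : Finset (Fin d)} {p : Finset (Fin d) → ℝ} (h : IsLaw A p) :
    regularize A a₀ p = p := if_pos h

lemma isLaw_regularize {a₀ : Finset (Fin d)} (h₀ : a₀ ∈ A) (p : Finset (Fin d) → ℝ) :
    IsLaw A (regularize A a₀ p) := by
  unfold regularize
  split_ifs with h
  · exact h
  · refine ⟨fun a => ?_, ?_⟩
    · by_cases ha : a = a₀
      · subst ha; simp
      · simp [ha]
    · rw [Finset.sum_pi_single', if_pos h₀]

lemma measurable_regularize (a₀ : Finset (Fin d)) : Measurable (regularize A a₀) := by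
  have h : MeasurableSet {p : Finset (Fin d) → ℝ | IsLaw A p} := by
    have : {p : Finset (Fin d) → ℝ | IsLaw A p} =
        (⋂ a, {p | 0 ≤ p a}) ∩ {p | ∑ a ∈ A, p a = 1} := by
      ext p
      simp only [Set.mem_ofPred_eq, Set.mem_inter_iff, Set.mem_iInter]
      exact ⟨fun h => ⟨h.1, h.2⟩, fun h => ⟨h.1, h.2⟩⟩
    rw [this]
    exact (MeasurableSet.iInter fun a =>
      measurableSet_le measurable_const (measurable_pi_apply a)).inter
      (measurableSet_eq_fun (Finset.measurable_fun_sum _ fun a _ => measurable_pi_apply a)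
        measurable_const)
  exact Measurable.ite h measurable_id measurable_const

end Measurability

lemma measurableSet_mem_act {Ω : Type*} {d : ℕ} {m : MeasurableSpace Ω} {f : Ω → Finset (Fin d)}
    (hf : Measurable[m] f) (i : Fin d) : MeasurableSet[m] {ω | i ∈ f ω} :=
  hf (MeasurableSet.of_discrete (s := {a : Finset (Fin d) | i ∈ a}))

/-! ### The game as a family of arm processes. -/

/-- An instance of the semi-bandit game played by thresholded Thompson Sampling. -/
structure Game {Ω : Type*} [mΩ : MeasurableSpace Ω] (P : Measure Ω) (T d : ℕ)
    (A : Finset (Finset (Fin d))) (γ : ℝ) where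
  ℓ : Ω → Fin T → Fin d → ℝ
  astar : (Fin T → Fin d → ℝ) → Finset (Fin d)
  act : Fin T → Ω → Finset (Fin d)
  measurable_ℓ : Measurable ℓ
  isOptimal : IsOptimalAction A astar
  isThompson : IsThresholdedThompsonSampling P A γ ℓ astar act
  nonempty : A.Nonempty
  γ_pos : 0 < γ
  γ_le : γ * d ≤ 1 / 2

namespace Game

variable {Ω : Type*} [mΩ : MeasurableSpace Ω] {P : Measure Ω} {T d : ℕ}
  {A : Finset (Finset (Fin d))} {γ : ℝ} (g : Game P T d A γ)

/-- The player's information after `n` rounds. -/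
abbrev info (n : ℕ) : MeasurableSpace Ω :=
  ⨆ s : {s : Fin T // s.val < n},
    MeasurableSpace.comap (fun ω => (g.act s ω, feedback (g.ℓ ω s) (g.act s ω))) inferInstance

/-- All the losses together with the actions of the first `n` rounds. -/
abbrev full (n : ℕ) : MeasurableSpace Ω :=
  MeasurableSpace.comap g.ℓ inferInstance ⊔
    ⨆ s : {s : Fin T // s.val < n}, MeasurableSpace.comap (g.act s) inferInstance

lemma info_mono : Monotone g.info := fun _ n h =>
  iSup_le fun s => le_iSup (fun s : {s : Fin T // s.val < n} =>
    MeasurableSpace.comap (fun ω => (g.act s ω, feedback (g.ℓ ω s) (g.act s ω))) inferInstance)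
    ⟨s.1, s.2.trans_le h⟩

lemma full_mono : Monotone g.full := fun _ n h =>
  sup_le_sup le_rfl (iSup_le fun s => le_iSup (fun s : {s : Fin T // s.val < n} =>
    MeasurableSpace.comap (g.act s) inferInstance) ⟨s.1, s.2.trans_le h⟩)

lemma measurable_ℓ_full (n : ℕ) : Measurable[g.full n] g.ℓ :=
  (comap_measurable g.ℓ).mono le_sup_left le_rfl

lemma measurable_act_full {n : ℕ} (s : Fin T) (h : s.val < n) : Measurable[g.full n] (g.act s) :=
  (comap_measurable (g.act s)).mono ((le_iSup (fun s : {s : Fin T // s.val < n} =>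
    MeasurableSpace.comap (g.act s) inferInstance) ⟨s, h⟩).trans le_sup_right) le_rfl

lemma measurable_obs {n : ℕ} (s : Fin T) (h : s.val < n) :
    Measurable[g.info n] fun ω => (g.act s ω, feedback (g.ℓ ω s) (g.act s ω)) :=
  (comap_measurable fun ω => (g.act s ω, feedback (g.ℓ ω s) (g.act s ω))).mono
    (le_iSup (fun s : {s : Fin T // s.val < n} =>
    MeasurableSpace.comap (fun ω => (g.act s ω, feedback (g.ℓ ω s) (g.act s ω))) inferInstance)
    ⟨s, h⟩) le_rfl

lemma measurable_loss_full (n : ℕ) (s : Fin T) (i : Fin d) :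
    Measurable[g.full n] fun ω => g.ℓ ω s i :=
  (measurable_pi_apply i).comp ((measurable_pi_apply s).comp (g.measurable_ℓ_full n))

lemma full_le (n : ℕ) : g.full n ≤ mΩ :=
  sup_le g.measurable_ℓ.comap_le (iSup_le fun s => (g.isThompson.measurable_act s).comap_le)

lemma info_le_full (n : ℕ) : g.info n ≤ g.full n := by
  refine iSup_le fun s => Measurable.comap_le ?_
  have ha := g.measurable_act_full s.1 s.2
  refine ha.prodMk (@measurable_pi_lambda _ _ _ (g.full n) _ _ fun i => ?_)
  exact Measurable.ite (measurableSet_mem_act ha i) (g.measurable_loss_full n s i)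
    measurable_const

lemma info_le (n : ℕ) : g.info n ≤ mΩ := (g.info_le_full n).trans (g.full_le n)

/-- The optimal action. -/
def opt (ω : Ω) : Finset (Fin d) := g.astar (g.ℓ ω)

lemma opt_mem (ω : Ω) : g.opt ω ∈ A := g.isOptimal.mem _

lemma measurable_opt_full (n : ℕ) : Measurable[g.full n] g.opt :=
  g.isOptimal.measurable.comp (g.measurable_ℓ_full n)

lemma measurable_opt : Measurable g.opt := (g.measurable_opt_full 0).mono (g.full_le 0) le_rfl

/-- The posterior law of the optimal action after `n` rounds. -/
def post (n : ℕ) (ω : Ω) (a : Finset (Fin d)) : ℝ := (P⟦{ω' | g.opt ω' = a} | g.info n⟧) ω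

/-- A version of the posterior law that is everywhere a probability vector. -/
def law (n : ℕ) (ω : Ω) : Finset (Fin d) → ℝ := regularize A g.nonempty.choose (g.post n ω)

/-- The rare arms. -/
def rare (n : ℕ) (ω : Ω) : Finset (Fin d) := rareArms A (g.law n ω) γ

lemma isLaw_law (n : ℕ) (ω : Ω) : IsLaw A (g.law n ω) :=
  isLaw_regularize A g.nonempty.choose_spec _

lemma measurable_law (n : ℕ) : Measurable[g.info n] (g.law n) :=
  (measurable_regularize A _).comp (@measurable_pi_lambda _ _ _ (g.info n) _ _ fun _ =>
    measurable_condExp_self)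

lemma measurable_rare (n : ℕ) : Measurable[g.info n] (g.rare n) :=
  (measurable_rareArms A γ).comp (g.measurable_law n)

lemma measurableSet_opt_eq (a : Finset (Fin d)) : MeasurableSet {ω | g.opt ω = a} :=
  g.measurable_opt (measurableSet_singleton a)

/-- The clause about `a ∉ A` is needed because the law of the played action is prescribed on all
finsets, whereas `playProb` sums over `A`. -/
lemma post_isLaw [IsProbabilityMeasure P] (n : ℕ) :
    ∀ᵐ ω ∂P, IsLaw A (g.post n ω) ∧ ∀ a ∉ A, g.post n ω a = 0 := by
  have hi : ∀ a, Integrable ({ω' | g.opt ω' = a}.indicator fun _ => (1 : ℝ)) P := fun a =>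
    (integrable_const _).indicator (g.measurableSet_opt_eq a)
  have h1 : ∀ᵐ ω ∂P, ∀ a, 0 ≤ g.post n ω a := by
    refine ae_all_iff.2 fun a => ?_
    exact condExp_nonneg (ae_of_all _ fun ω => Set.indicator_nonneg (fun _ _ => zero_le_one) ω)
  have h2 : ∀ᵐ ω ∂P, ∑ a ∈ A, g.post n ω a = 1 := by
    have h3 := condExp_finsetSum (s := A)
      (f := fun a => {ω' | g.opt ω' = a}.indicator fun _ => (1 : ℝ)) (fun a _ => hi a) (g.info n)
    have h4 : (∑ a ∈ A, {ω' | g.opt ω' = a}.indicator fun _ => (1 : ℝ)) = fun _ => (1 : ℝ) := by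
      funext ω
      simp only [Finset.sum_apply, Set.indicator_apply, Set.mem_ofPred_eq]
      rw [Finset.sum_ite_eq, if_pos (g.opt_mem ω)]
    rw [h4, condExp_const (g.info_le n)] at h3
    filter_upwards [h3] with ω hω
    rw [Finset.sum_apply] at hω
    exact hω.symm
  have h5 : ∀ᵐ ω ∂P, ∀ a, a ∉ A → g.post n ω a = 0 := by
    refine ae_all_iff.2 fun a => ?_
    by_cases ha : a ∈ A
    · exact ae_of_all _ fun ω h => absurd ha h
    · have h6 : {ω' | g.opt ω' = a} = ∅ := by
        ext ω
        simp only [Set.mem_ofPred_eq, Set.mem_empty_iff_false, iff_false]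
        rintro rfl
        exact ha (g.opt_mem ω)
      refine ae_of_all _ fun ω _ => ?_
      unfold post
      rw [h6, Set.indicator_empty, condExp_const (g.info_le n)]
  filter_upwards [h1, h2, h5] with ω a b c using ⟨⟨a, b⟩, c⟩

lemma law_ae_eq [IsProbabilityMeasure P] (n : ℕ) : ∀ᵐ ω ∂P, g.law n ω = g.post n ω :=
  (g.post_isLaw n).mono fun _ h => regularize_of_isLaw A h.1

/-- The loss of arm `i` in round `n`, truncated to `[0, 1]`. -/
def loss (i : Fin d) (n : ℕ) (ω : Ω) : ℝ :=
  -- Losses lie in `[0, 1]` only almost surely. Truncation makes the bounds of `ArmProcess` hold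
  -- everywhere, and rounds from `T` on are padded with zero loss.
  if h : n < T then max 0 (min 1 (g.ℓ ω ⟨n, h⟩ i)) else 0

/-- The indicator that arm `i` is played in round `n`. -/
def played (i : Fin d) (n : ℕ) (ω : Ω) : ℝ :=
  if h : n < T then {ω | i ∈ g.act ⟨n, h⟩ ω}.indicator (fun _ => 1) ω else 0

lemma played_eq (i : Fin d) (n : ℕ) (ω : Ω) : g.played i n ω = 0 ∨ g.played i n ω = 1 := by
  unfold played
  split_ifs
  · by_cases h : i ∈ g.act ⟨n, by assumption⟩ ω
    · right; simp [h]
    · left; simp [h]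
  · exact Or.inl rfl

lemma condExp_played [IsProbabilityMeasure P] (i : Fin d) {n : ℕ} (hn : n < T) :
    P[g.played i n | g.full n] =ᵐ[P] fun ω => playProb A (g.law n ω) γ i := by
  have h1 : g.played i n = ∑ a : Finset (Fin d) with i ∈ a,
      {ω | g.act ⟨n, hn⟩ ω = a}.indicator fun _ => (1 : ℝ) := by
    funext ω
    unfold played
    rw [dif_pos hn]
    simp only [Finset.sum_apply, Set.indicator_apply, Set.mem_ofPred_eq]
    rw [Finset.sum_ite_eq]
    simp
  have hi : ∀ a, Integrable ({ω | g.act ⟨n, hn⟩ ω = a}.indicator fun _ => (1 : ℝ)) P := fun a =>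
    (integrable_const _).indicator (g.isThompson.measurable_act _ (measurableSet_singleton a))
  have h2 : ∀ᵐ ω ∂P, ∀ a, (P⟦{ω | g.act ⟨n, hn⟩ ω = a} | g.full n⟧) ω =
      thresholdedLaw A (g.post n ω) γ a :=
    ae_all_iff.2 fun a => g.isThompson.law_act ⟨n, hn⟩ a
  rw [h1]
  filter_upwards [condExp_finsetSum (fun a _ => hi a) (g.full n), h2, g.law_ae_eq n,
    g.post_isLaw n] with ω h3 h4 h5 h6
  rw [h3, Finset.sum_apply, Finset.sum_congr rfl fun a _ => h4 a, h5, playProb]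
  symm
  refine Finset.sum_subset (Finset.filter_subset_filter _ (Finset.subset_univ A))
    fun a ha hA => ?_
  have : a ∉ A := fun h => hA (Finset.mem_filter.2 ⟨h, (Finset.mem_filter.1 ha).2⟩)
  unfold thresholdedLaw
  rw [h6.2 a this, zero_div, ite_self]

/-- The process of a single arm. -/
def arm [IsProbabilityMeasure P] (i : Fin d) : ArmProcess P γ where
  F := g.info
  G := g.full
  x := g.loss i
  I := g.played i
  π n ω := if n < T then playProb A (g.law n ω) γ i else 0
  N n ω := if n < T then {ω | i ∉ g.rare n ω}.indicator (fun _ => 1) ω else 0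
  F_mono := g.info_mono
  G_mono := g.full_mono
  F_le_G := g.info_le_full
  G_le := g.full_le
  x_meas n := by
    unfold loss
    split_ifs with h
    · exact measurable_const.max (measurable_const.min (g.measurable_loss_full 0 ⟨n, h⟩ i))
    · exact measurable_const
  x_nonneg n ω := by
    unfold loss
    split_ifs
    · exact le_max_left _ _
    · exact le_rfl
  x_le n ω := by
    unfold loss
    split_ifs
    · exact max_le zero_le_one (min_le_left _ _)
    · exact zero_le_one
  I_meas n := by
    unfold played
    split_ifs with h
    · exact Measurable.indicator measurable_const
        (measurableSet_mem_act (g.measurable_act_full ⟨n, h⟩ n.lt_succ_self) i)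
    · exact measurable_const
  I_eq := g.played_eq i
  obs_meas n := by
    unfold loss played
    split_ifs with h
    -- Truncation fixes 0, so it commutes with masking and the truncated loss is a function of the
    -- feedback.
    · have h1 : (fun ω => {ω | i ∈ g.act ⟨n, h⟩ ω}.indicator (fun _ => (1 : ℝ)) ω *
          max 0 (min 1 (g.ℓ ω ⟨n, h⟩ i))) =
          fun ω => max 0 (min 1 (feedback (g.ℓ ω ⟨n, h⟩) (g.act ⟨n, h⟩ ω) i)) := by
        funext ω
        unfold feedback
        by_cases hi : i ∈ g.act ⟨n, h⟩ ω <;> simp [hi]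
      rw [h1]
      exact measurable_const.max (measurable_const.min ((measurable_pi_apply i).comp
        (measurable_snd.comp (g.measurable_obs ⟨n, h⟩ n.lt_succ_self))))
    · simp only [mul_zero]
      exact measurable_const
  π_meas n := by
    split_ifs
    · exact (measurable_playProb A γ i).comp (g.measurable_law n)
    · exact measurable_const
  π_nonneg n ω := by
    split_ifs
    · exact playProb_nonneg (g.isLaw_law n ω) g.γ_pos g.γ_le i
    · exact le_rfl
  π_le n ω := by
    split_ifs
    · exact playProb_le_one (g.isLaw_law n ω) g.γ_pos g.γ_le i
    · exact zero_le_one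
  N_meas n := by
    split_ifs
    · exact Measurable.indicator measurable_const
        ((measurableSet_mem_act (g.measurable_rare n) i).compl)
    · exact measurable_const
  N_eq n ω := by
    split_ifs
    · by_cases h : i ∈ g.rare n ω
      · left; simp [h]
      · right; simp [h]
    · exact Or.inl rfl
  le_π n ω h := by
    split_ifs at h ⊢
    · by_cases hi : i ∈ g.rare n ω
      · simp [hi] at h
      · exact (lt_cleanProb A _ γ hi).le.trans
          (cleanProb_le_playProb (g.isLaw_law n ω) g.γ_pos g.γ_le i)
    · simp at h
  law n := by
    by_cases hn : n < T
    · simp only [hn, if_true]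
      exact g.condExp_played i hn
    · have h1 : g.played i n = fun _ => (0 : ℝ) := by
        funext ω; unfold played; rw [dif_neg hn]
      rw [h1, condExp_const (g.full_le n)]
      simp only [hn, if_false]
      rfl

/-- The indicator that the optimal action contains no rare arm. -/
def clean (n : ℕ) (ω : Ω) : ℝ := {ω | Disjoint (g.opt ω) (g.rare n ω)}.indicator (fun _ => 1) ω

/-- The indicator that `i` belongs to the optimal action. -/
def isBest (i : Fin d) (ω : Ω) : ℝ := {ω | i ∈ g.opt ω}.indicator (fun _ => 1) ω

lemma isBest_eq (i : Fin d) (ω : Ω) : g.isBest i ω = if i ∈ g.opt ω then 1 else 0 := by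
  simp [isBest, Set.indicator_apply]

lemma clean_eq (n : ℕ) (ω : Ω) :
    g.clean n ω = if Disjoint (g.opt ω) (g.rare n ω) then 1 else 0 := by
  simp [clean, Set.indicator_apply]

lemma clean_nonneg (n : ℕ) (ω : Ω) : 0 ≤ g.clean n ω := by rw [clean_eq]; split_ifs <;> simp

lemma clean_le (n : ℕ) (ω : Ω) : g.clean n ω ≤ 1 := by rw [clean_eq]; split_ifs <;> simp

lemma measurable_isBest_full (i : Fin d) : Measurable[g.full 0] (g.isBest i) :=
  Measurable.indicator measurable_const (measurableSet_mem_act (g.measurable_opt_full 0) i)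

lemma measurable_isBest (i : Fin d) : Measurable (g.isBest i) :=
  (g.measurable_isBest_full i).mono (g.full_le 0) le_rfl

lemma measurable_clean (n : ℕ) : Measurable (g.clean n) := by
  have h : {ω | Disjoint (g.opt ω) (g.rare n ω)} =
      (fun ω => (g.opt ω, g.rare n ω)) ⁻¹' {z | Disjoint z.1 z.2} := rfl
  refine Measurable.indicator measurable_const ?_
  rw [h]
  exact (g.measurable_opt.prodMk ((g.measurable_rare n).mono (g.info_le n) le_rfl))
    MeasurableSet.of_discrete

lemma isBest_nonneg (i : Fin d) (ω : Ω) : 0 ≤ g.isBest i ω := by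
  rw [isBest_eq]; split_ifs <;> simp

lemma isBest_le (i : Fin d) (ω : Ω) : g.isBest i ω ≤ 1 := by
  rw [isBest_eq]; split_ifs <;> simp

/-- The rare set is known to the player. Expanding over the values `a` of the optimal action, the
indicator that `a` avoids it leaves the conditional expectation. -/
lemma condExp_isBest_mul_clean [IsProbabilityMeasure P] (i : Fin d) (n : ℕ) :
    P[fun ω => g.isBest i ω * g.clean n ω | g.info n] =ᵐ[P]
      fun ω => cleanProb A (g.law n ω) (g.rare n ω) i := by
  set D : Finset (Fin d) → Ω → ℝ := fun a => {ω | Disjoint a (g.rare n ω)}.indicator fun _ => 1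
  set E : Finset (Fin d) → Ω → ℝ := fun a => {ω | g.opt ω = a}.indicator fun _ => 1
  have hDm : ∀ a, Measurable[g.info n] (D a) := fun a => Measurable.indicator measurable_const
    (g.measurable_rare n (MeasurableSet.of_discrete (s := {R : Finset (Fin d) | Disjoint a R})))
  have hDb : ∀ a ω, |D a ω| ≤ 1 := fun a ω => by
    by_cases h : Disjoint a (g.rare n ω) <;> simp [D, h]
  have hEi : ∀ a, Integrable (E a) P := fun a =>
    (integrable_const _).indicator (g.measurableSet_opt_eq a)
  have hDE : ∀ a, Integrable (D a * E a) P := fun a =>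
    (hEi a).bdd_mul ((hDm a).mono (g.info_le n) le_rfl).aestronglyMeasurable (c := 1)
      (ae_of_all _ (hDb a))
  have h1 : (fun ω => g.isBest i ω * g.clean n ω) = ∑ a ∈ A with i ∈ a, D a * E a := by
    funext ω
    rw [isBest_eq, clean_eq]
    simp only [D, E, Finset.sum_apply, Pi.mul_apply, Set.indicator_apply, Set.mem_ofPred_eq,
      mul_ite, mul_one, mul_zero]
    rw [Finset.sum_ite_eq]
    simp only [Finset.mem_filter, g.opt_mem ω, true_and]
    split_ifs <;> rfl
  have h2 : ∀ᵐ ω ∂P, ∀ a, (P[D a * E a | g.info n]) ω = D a ω * g.post n ω a :=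
    ae_all_iff.2 fun a => condExp_stronglyMeasurable_mul_of_bound (g.info_le n)
      (hDm a).stronglyMeasurable (hEi a) 1 (ae_of_all _ (hDb a))
  rw [h1]
  filter_upwards [condExp_finsetSum (fun a _ => hDE a) (g.info n), h2, g.law_ae_eq n]
    with ω h3 h4 h5
  rw [h3, Finset.sum_apply, Finset.sum_congr rfl fun a _ => h4 a, h5]
  unfold cleanProb
  rw [← Finset.filter_filter, Finset.sum_filter (fun a => Disjoint a (g.rare n ω))]
  refine Finset.sum_congr rfl fun a _ => ?_
  simp only [D, Set.indicator_apply, Set.mem_ofPred_eq, ite_mul, one_mul, zero_mul]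

/-- The part of the posterior mean of `s` in which the optimal action contains no rare arm. -/
def cleanPart (P : Measure Ω) (g : Game P T d A γ) (s : Ω → ℝ) (n : ℕ) : Ω → ℝ :=
  P[fun ω => s ω * g.clean n ω | g.info n]

variable [IsProbabilityMeasure P]

lemma integrable_mul_clean {s : Ω → ℝ} (hs : Measurable s) (hs0 : ∀ ω, 0 ≤ s ω)
    (hs1 : ∀ ω, s ω ≤ 1) (n : ℕ) : Integrable (fun ω => s ω * g.clean n ω) P :=
  integrable_of_abs_le (hs.mul (g.measurable_clean n)) (C := 1) fun ω => by
    rw [abs_of_nonneg (mul_nonneg (hs0 ω) (g.clean_nonneg n ω))]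
    exact mul_le_one₀ (hs1 ω) (g.clean_nonneg n ω) (g.clean_le n ω)

/-- The bound by `π` is where Thompson Sampling enters: the clean posterior of an arm is at most the
probability of playing it. -/
lemma cleanPart_bounds {s : Ω → ℝ} (hs : Measurable s) (hs0 : ∀ ω, 0 ≤ s ω) (i : Fin d)
    (hsi : ∀ ω, s ω ≤ g.isBest i ω) (n : ℕ) :
    ∀ᵐ ω ∂P, 0 ≤ cleanPart P g s n ω ∧ cleanPart P g s n ω ≤ (P[s | (g.arm i).F n]) ω ∧
      ((g.arm i).N n ω = 1 → cleanPart P g s n ω ≤ (g.arm i).π n ω) := by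
  have hs1 : ∀ ω, s ω ≤ 1 := fun ω => (hsi ω).trans (g.isBest_le i ω)
  have hint := g.integrable_mul_clean hs hs0 hs1 n
  have h1 : 0 ≤ᵐ[P] cleanPart P g s n :=
    condExp_nonneg (ae_of_all _ fun ω => mul_nonneg (hs0 ω) (g.clean_nonneg n ω))
  have h2 : cleanPart P g s n ≤ᵐ[P] P[s | (g.arm i).F n] :=
    condExp_mono hint (integrable_of_abs_le hs (C := 1) fun ω => by
      rw [abs_of_nonneg (hs0 ω)]; exact hs1 ω)
      (ae_of_all _ fun ω => mul_le_of_le_one_right (hs0 ω) (g.clean_le n ω))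
  have h3 : cleanPart P g s n ≤ᵐ[P] P[fun ω => g.isBest i ω * g.clean n ω | g.info n] :=
    condExp_mono hint (g.integrable_mul_clean (g.measurable_isBest i) (g.isBest_nonneg i)
      (g.isBest_le i) n)
      (ae_of_all _ fun ω => mul_le_mul_of_nonneg_right (hsi ω) (g.clean_nonneg n ω))
  filter_upwards [h1, h2, h3, g.condExp_isBest_mul_clean i n] with ω a b c e
  refine ⟨a, b, fun hN => ?_⟩
  rw [e] at c
  have hn : n < T := by
    by_contra hn
    simp [arm, hn] at hN
  have h4 : (g.arm i).π n ω = playProb A (g.law n ω) γ i := by simp [arm, hn]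
  rw [h4]
  exact c.trans (cleanProb_le_playProb (g.isLaw_law n ω) g.γ_pos g.γ_le i)

lemma sum_cleanPart {K : Finset ℕ} {s : ℕ → Ω → ℝ} (hs : ∀ k, Measurable (s k))
    (hs0 : ∀ k ω, 0 ≤ s k ω) (hs1 : ∀ k ω, s k ω ≤ 1) (i : Fin d)
    (hsum : ∀ ω, ∑ k ∈ K, s k ω = g.isBest i ω) (n : ℕ) :
    ∀ᵐ ω ∂P, ∑ k ∈ K, cleanPart P g (s k) n ω = cleanProb A (g.law n ω) (g.rare n ω) i := by
  have h1 : (∑ k ∈ K, fun ω => s k ω * g.clean n ω) = fun ω => g.isBest i ω * g.clean n ω := by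
    funext ω
    rw [Finset.sum_apply, ← hsum ω, Finset.sum_mul]
  have h2 := condExp_finsetSum (s := K) (f := fun k ω => s k ω * g.clean n ω)
    (fun k _ => g.integrable_mul_clean (hs k) (hs0 k) (hs1 k) n) (g.info n)
  rw [h1] at h2
  filter_upwards [h2, g.condExp_isBest_mul_clean i n] with ω h3 h4
  rw [← h4, h3, Finset.sum_apply]
  rfl

/-- The regret attributed to a single arm. -/
lemma arm_regret_le {K : Finset ℕ} {s : ℕ → Ω → ℝ} (hs : ∀ k, Measurable (s k))
    (hs0 : ∀ k ω, 0 ≤ s k ω) (hs1 : ∀ k ω, s k ω ≤ 1) (i : Fin d)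
    (hsum : ∀ ω, ∑ k ∈ K, s k ω = g.isBest i ω) (n : ℕ) :
    ∫ ω, (g.arm i).π n ω * (g.arm i).x n ω ∂P - ∫ ω, g.isBest i ω * (g.arm i).x n ω ∂P ≤
      γ * d * ∫ ω, (g.arm i).π n ω * (g.arm i).x n ω ∂P +
      ∑ k ∈ K, ∫ ω, (g.arm i).N n ω * (cleanPart P g (s k) n ω - s k ω) * (g.arm i).x n ω ∂P := by
  set X := g.arm i with hX
  have hsi : ∀ k ∈ K, ∀ ω, s k ω ≤ g.isBest i ω := fun k hk ω => by
    rw [← hsum ω]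
    exact Finset.single_le_sum (f := fun k => s k ω) (fun k _ => hs0 k ω) hk
  have j1 : Integrable (fun ω => X.π n ω * X.x n ω) P :=
    integrable_of_abs_le ((X.π_meas' n).mul (X.x_meas' n)) (C := 1) fun ω => by
      rw [abs_of_nonneg (mul_nonneg (X.π_nonneg n ω) (X.x_nonneg n ω))]
      exact mul_le_one₀ (X.π_le n ω) (X.x_nonneg n ω) (X.x_le n ω)
  have j2 : Integrable (fun ω => g.isBest i ω * X.x n ω) P :=
    integrable_of_abs_le ((g.measurable_isBest i).mul (X.x_meas' n)) (C := 1) fun ω => by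
      rw [abs_of_nonneg (mul_nonneg (g.isBest_nonneg i ω) (X.x_nonneg n ω))]
      exact mul_le_one₀ (g.isBest_le i ω) (X.x_nonneg n ω) (X.x_le n ω)
  have j3 : ∀ k ∈ K, Integrable
      (fun ω => X.N n ω * (cleanPart P g (s k) n ω - s k ω) * X.x n ω) P := fun k hk => by
    have hc : Integrable (cleanPart P g (s k) n) P := integrable_condExp
    have hsk : Integrable (s k) P := integrable_of_abs_le (hs k) (C := 1) fun ω => by
      rw [abs_of_nonneg (hs0 k ω)]; exact hs1 k ω
    refine ((hc.sub hsk).bdd_mul (c := 1) (X.N_meas' n).aestronglyMeasurable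
      (ae_of_all _ fun ω => ?_)).mul_bdd (c := 1) (X.x_meas' n).aestronglyMeasurable
      (ae_of_all _ fun ω => ?_)
    · rw [Real.norm_eq_abs, abs_of_nonneg (X.N_nonneg n ω)]; exact X.N_le n ω
    · rw [Real.norm_eq_abs, abs_of_nonneg (X.x_nonneg n ω)]; exact X.x_le n ω
  rw [← integral_finsetSum _ j3, ← integral_sub j1 j2, ← integral_const_mul,
    ← integral_add (j1.const_mul _) (integrable_finsetSum _ j3)]
  refine integral_mono_ae (j1.sub j2) ((j1.const_mul _).add (integrable_finsetSum _ j3)) ?_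
  filter_upwards [g.sum_cleanPart hs hs0 hs1 i hsum n] with ω hω
  have hx := X.x_nonneg n ω
  have hb := g.isBest_nonneg i ω
  have hsum' : ∑ k ∈ K, X.N n ω * (cleanPart P g (s k) n ω - s k ω) * X.x n ω =
      X.N n ω * (cleanProb A (g.law n ω) (g.rare n ω) i - g.isBest i ω) * X.x n ω := by
    rw [← Finset.sum_mul, ← Finset.mul_sum, Finset.sum_sub_distrib, hω, hsum ω]
  rw [hsum']
  have hr : g.rare n ω = rareArms A (g.law n ω) γ := rfl
  by_cases hn : n < T
  · have hπ : X.π n ω = playProb A (g.law n ω) γ i := by simp [hX, arm, hn]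
    -- A rare arm is never played, so its contribution to the regret is nonpositive.
    by_cases hi : i ∈ g.rare n ω
    · have hN : X.N n ω = 0 := by simp [hX, arm, hi]
      have hπ0 : X.π n ω = 0 := by
        rw [hπ, playProb_eq, ← hr, cleanProb_of_mem hi, zero_div]
      rw [hN, hπ0]
      simp only [zero_mul, mul_zero, add_zero, zero_sub]
      exact neg_nonpos.2 (mul_nonneg hb hx)
    · have hN : X.N n ω = 1 := by simp [hX, arm, hn, hi]
      have h1 := playProb_le (g.isLaw_law n ω) g.γ_pos g.γ_le i
      rw [hN, hπ, one_mul]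
      have h2 := mul_le_mul_of_nonneg_right h1 hx
      rw [hr]
      linarith
  · have hx0 : X.x n ω = 0 := by simp [hX, arm, loss, hn]
    simp [hx0]

end Game

/-! ### Dyadic bins for the losses of the optimal arms, and the decomposition of the regret. -/

/-- The largest `k ≤ K` such that `z ≤ L / 2 ^ k` (and `0` if there is none). -/
def lossBin (L : ℝ) (K : ℕ) (z : ℝ) : ℕ := by
  classical exact Nat.findGreatest (fun k => z ≤ L / 2 ^ k) K

lemma lossBin_le (L : ℝ) (K : ℕ) (z : ℝ) : lossBin L K z ≤ K := Nat.findGreatest_le K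

lemma le_of_lossBin {L : ℝ} {K : ℕ} {z : ℝ} (hz : z ≤ L) : z ≤ L / 2 ^ lossBin L K z := by
  classical
  exact Nat.findGreatest_spec (P := fun k => z ≤ L / 2 ^ k) (Nat.zero_le K) (by simpa using hz)

lemma lt_of_lossBin_lt {L : ℝ} {K : ℕ} {z : ℝ} (h : lossBin L K z < K) :
    L / 2 ^ (lossBin L K z + 1) < z := by
  classical
  exact not_le.1 (Nat.findGreatest_is_greatest (P := fun k => z ≤ L / 2 ^ k)
    (Nat.lt_succ_self _) h)

lemma measurable_lossBin (L : ℝ) (K : ℕ) : Measurable (lossBin L K) := by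
  classical
  exact measurable_findGreatest fun k _ => measurableSet_le measurable_id measurable_const

namespace Game

variable {Ω : Type*} [mΩ : MeasurableSpace Ω] {P : Measure Ω} {T d : ℕ}
  {A : Finset (Finset (Fin d))} {γ : ℝ} (g : Game P T d A γ)

/-- The cumulative (truncated) loss of the arm `i`. -/
def cumLoss (i : Fin d) (ω : Ω) : ℝ := ∑ n ∈ Finset.range T, g.loss i n ω

lemma loss_nonneg (i : Fin d) (n : ℕ) (ω : Ω) : 0 ≤ g.loss i n ω := by
  unfold loss
  split_ifs
  · exact le_max_left _ _
  · exact le_rfl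

lemma cumLoss_nonneg (i : Fin d) (ω : Ω) : 0 ≤ g.cumLoss i ω :=
  Finset.sum_nonneg fun n _ => g.loss_nonneg i n ω

/-- The indicator that the arm `i` is in the optimal action and has its loss in the `k`-th bin. -/
def binInd (L : ℝ) (K : ℕ) (i : Fin d) (k : ℕ) (ω : Ω) : ℝ :=
  {ω | i ∈ g.opt ω ∧ lossBin L K (g.cumLoss i ω) = k}.indicator (fun _ => 1) ω

lemma binInd_eq (L : ℝ) (K : ℕ) (i : Fin d) (k : ℕ) (ω : Ω) : g.binInd L K i k ω =
    if i ∈ g.opt ω ∧ lossBin L K (g.cumLoss i ω) = k then 1 else 0 := by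
  simp [binInd, Set.indicator_apply]

lemma binInd_nonneg (L : ℝ) (K : ℕ) (i : Fin d) (k : ℕ) (ω : Ω) : 0 ≤ g.binInd L K i k ω := by
  rw [binInd_eq]; split_ifs <;> simp

lemma binInd_le_isBest (L : ℝ) (K : ℕ) (i : Fin d) (k : ℕ) (ω : Ω) :
    g.binInd L K i k ω ≤ g.isBest i ω := by
  rw [binInd_eq, isBest_eq]
  split_ifs <;> simp_all

lemma binInd_le (L : ℝ) (K : ℕ) (i : Fin d) (k : ℕ) (ω : Ω) : g.binInd L K i k ω ≤ 1 :=
  (g.binInd_le_isBest L K i k ω).trans (g.isBest_le i ω)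

lemma sum_binInd (L : ℝ) (K : ℕ) (i : Fin d) (ω : Ω) :
    ∑ k ∈ Finset.range (K + 1), g.binInd L K i k ω = g.isBest i ω := by
  rw [isBest_eq]
  simp only [binInd_eq]
  by_cases h : i ∈ g.opt ω
  · simp only [h, true_and, if_true]
    rw [Finset.sum_ite_eq, if_pos (Finset.mem_range_succ_iff.2 (lossBin_le L K _))]
  · simp [h]

variable [IsProbabilityMeasure P]

lemma measurable_cumLoss_full (i : Fin d) : Measurable[g.full 0] (g.cumLoss i) :=
  Finset.measurable_fun_sum _ fun n _ => (g.arm i).x_meas n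

lemma measurable_binInd_full (L : ℝ) (K : ℕ) (i : Fin d) (k : ℕ) :
    Measurable[g.full 0] (g.binInd L K i k) := by
  refine Measurable.indicator measurable_const ?_
  exact (measurableSet_mem_act (g.measurable_opt_full 0) i).inter
    (((measurable_lossBin L K).comp (g.measurable_cumLoss_full i)) (measurableSet_singleton k))

lemma measurable_binInd (L : ℝ) (K : ℕ) (i : Fin d) (k : ℕ) : Measurable (g.binInd L K i k) :=
  (g.measurable_binInd_full L K i k).mono (g.full_le 0) le_rfl

omit [IsProbabilityMeasure P] in
lemma loss_ae_eq (h01 : ∀ᵐ ω ∂P, ∀ t i, g.ℓ ω t i ∈ Set.Icc (0 : ℝ) 1) :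
    ∀ᵐ ω ∂P, ∀ (t : Fin T) (i : Fin d), g.loss i t ω = g.ℓ ω t i := by
  filter_upwards [h01] with ω h t i
  unfold loss
  rw [dif_pos t.2, min_eq_right (h t i).2, max_eq_right (h t i).1]

omit [IsProbabilityMeasure P] in
lemma totalLoss_opt (ω : Ω) : totalLoss (g.ℓ ω) (g.opt ω) = bestLoss A g.nonempty (g.ℓ ω) :=
  le_antisymm (Finset.le_inf' _ _ fun b hb => g.isOptimal.le _ b hb)
    (Finset.inf'_le _ (g.opt_mem ω))

omit [IsProbabilityMeasure P] in
lemma sum_cumLoss_eq (h01 : ∀ᵐ ω ∂P, ∀ t i, g.ℓ ω t i ∈ Set.Icc (0 : ℝ) 1) :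
    ∀ᵐ ω ∂P, ∑ i ∈ g.opt ω, g.cumLoss i ω = bestLoss A g.nonempty (g.ℓ ω) := by
  filter_upwards [g.loss_ae_eq h01] with ω h
  rw [← g.totalLoss_opt, totalLoss, Finset.sum_comm]
  refine Finset.sum_congr rfl fun i _ => ?_
  rw [cumLoss, Finset.sum_range]
  exact Finset.sum_congr rfl fun t _ => h t i

variable {L : ℝ} (hL : 0 < L) (h01 : ∀ᵐ ω ∂P, ∀ t i, g.ℓ ω t i ∈ Set.Icc (0 : ℝ) 1)
  (hbest : ∀ᵐ ω ∂P, bestLoss A g.nonempty (g.ℓ ω) ≤ L)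

omit [IsProbabilityMeasure P] in
include h01 hbest in
lemma cumLoss_le : ∀ᵐ ω ∂P, ∀ i ∈ g.opt ω, g.cumLoss i ω ≤ L := by
  filter_upwards [g.sum_cumLoss_eq h01, hbest] with ω h1 h2 i hi
  exact (Finset.single_le_sum (f := fun i => g.cumLoss i ω)
    (fun j _ => g.cumLoss_nonneg j ω) hi).trans (h1.le.trans h2)

omit [IsProbabilityMeasure P] in
include h01 hbest in
lemma cumLoss_le_of_isBest (i : Fin d) :
    ∀ᵐ ω ∂P, g.isBest i ω ≠ 0 → g.cumLoss i ω ≤ L := by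
  filter_upwards [g.cumLoss_le h01 hbest] with ω h hs
  rw [isBest_eq] at hs
  exact h i (by_contra fun hi => hs (if_neg hi))

omit [IsProbabilityMeasure P] in
include h01 hbest in
lemma cumLoss_le_of_binInd (K : ℕ) (i : Fin d) (k : ℕ) :
    ∀ᵐ ω ∂P, g.binInd L K i k ω ≠ 0 → g.cumLoss i ω ≤ L / 2 ^ k := by
  filter_upwards [g.cumLoss_le h01 hbest] with ω h hs
  rw [binInd_eq] at hs
  have hi : i ∈ g.opt ω ∧ lossBin L K (g.cumLoss i ω) = k := by_contra fun hi => hs (if_neg hi)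
  rw [← hi.2]
  exact le_of_lossBin (h i hi.1)

include hL h01 hbest in
/-- An optimal action has few arms with a large loss. -/
lemma sum_integral_binInd_le {m K : ℕ} (hAm : ∀ a ∈ A, a.card = m) (hK : m ≤ 2 ^ K) {k : ℕ}
    (hk : k ≤ K) : ∑ i, ∫ ω, g.binInd L K i k ω ∂P ≤ 2 ^ (k + 1) := by
  have hi : ∀ i, Integrable (g.binInd L K i k) P := fun i =>
    integrable_of_abs_le (g.measurable_binInd L K i k) (C := 1) fun ω => by
      rw [abs_of_nonneg (g.binInd_nonneg L K i k ω)]; exact g.binInd_le L K i k ω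
  rw [← integral_finsetSum _ fun i _ => hi i]
  calc ∫ ω, ∑ i, g.binInd L K i k ω ∂P ≤ ∫ _ω, (2 : ℝ) ^ (k + 1) ∂P := by
        refine integral_mono_ae (integrable_finsetSum _ fun i _ => hi i) (integrable_const _) ?_
        filter_upwards [g.sum_cumLoss_eq h01, hbest] with ω h1 h2
        simp only [binInd_eq]
        rw [← Finset.sum_filter, Finset.sum_const, nsmul_eq_mul, mul_one]
        set S : Finset (Fin d) :=
          Finset.univ.filter fun i => i ∈ g.opt ω ∧ lossBin L K (g.cumLoss i ω) = k with hS
        have hsub : S ⊆ g.opt ω := fun i hi => (Finset.mem_filter.1 hi).2.1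
        -- Below the top bin each arm has loss above `L / 2^(k+1)`, and these sum to at most `L`.
        -- The top bin has no lower bound on the losses, and there the count is at most `m ≤ 2^K`.
        rcases hk.lt_or_eq with hk | rfl
        · have h3 : S.card * (L / 2 ^ (k + 1)) ≤ L := by
            rw [← nsmul_eq_mul, ← Finset.sum_const]
            refine le_trans (Finset.sum_le_sum (g := fun i => g.cumLoss i ω) fun i hi => ?_)
              ((Finset.sum_le_sum_of_subset_of_nonneg hsub
                fun j _ _ => g.cumLoss_nonneg j ω).trans (h1.le.trans h2))
            have h4 := (Finset.mem_filter.1 hi).2.2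
            have := lt_of_lossBin_lt (L := L) (K := K) (z := g.cumLoss i ω) (by omega)
            rw [h4] at this
            exact this.le
          have h5 : (S.card : ℝ) * (L / 2 ^ (k + 1)) = S.card / 2 ^ (k + 1) * L := by ring
          rw [h5] at h3
          have h6 : (S.card : ℝ) / 2 ^ (k + 1) ≤ 1 := by
            by_contra! hc
            nlinarith
          exact (div_le_one (by positivity)).1 h6
        · have h3 : S.card ≤ 2 ^ (k + 1) := by
            have := Finset.card_le_card hsub
            rw [hAm _ (g.opt_mem ω)] at this
            exact (this.trans hK).trans (Nat.pow_le_pow_right two_pos k.le_succ)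
          exact_mod_cast h3
    _ = _ := by simp

/-- The expected loss of the player. -/
def playerLoss : ℝ :=
  ∑ i, ∑ n ∈ Finset.range T, ∫ ω, (g.arm i).π n ω * (g.arm i).x n ω ∂P

/-- The expected loss of the optimal action. -/
def optLoss : ℝ :=
  ∑ i, ∑ n ∈ Finset.range T, ∫ ω, g.isBest i ω * (g.arm i).x n ω ∂P

lemma integrable_isBest_mul (i : Fin d) (n : ℕ) :
    Integrable (fun ω => g.isBest i ω * (g.arm i).x n ω) P :=
  integrable_of_abs_le ((g.measurable_isBest i).mul ((g.arm i).x_meas' n)) (C := 1) fun ω => by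
    rw [abs_of_nonneg (mul_nonneg (g.isBest_nonneg i ω) ((g.arm i).x_nonneg n ω))]
    exact mul_le_one₀ (g.isBest_le i ω) ((g.arm i).x_nonneg n ω) ((g.arm i).x_le n ω)

lemma sum_isBest_mul (ω : Ω) :
    ∑ i, ∑ n ∈ Finset.range T, g.isBest i ω * (g.arm i).x n ω =
      ∑ i ∈ g.opt ω, g.cumLoss i ω := by
  simp_rw [← Finset.mul_sum, isBest_eq, ite_mul, one_mul, zero_mul]
  rw [← Finset.sum_filter, Finset.filter_mem_eq_inter, Finset.univ_inter]
  rfl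

include h01 hbest in
lemma optLoss_le : g.optLoss ≤ L := by
  unfold optLoss
  simp_rw [← integral_finsetSum _ fun n _ => g.integrable_isBest_mul _ n]
  have hi : ∀ i, Integrable
      (fun ω => ∑ n ∈ Finset.range T, g.isBest i ω * (g.arm i).x n ω) P := fun i =>
    integrable_finsetSum _ fun n _ => g.integrable_isBest_mul i n
  rw [← integral_finsetSum _ fun i _ => hi i]
  calc _ ≤ ∫ _ω, L ∂P := by
        refine integral_mono_ae (integrable_finsetSum _ fun i _ => hi i) (integrable_const _) ?_
        filter_upwards [g.sum_cumLoss_eq h01, hbest] with ω h1 h2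
        rw [g.sum_isBest_mul, h1]
        exact h2
    _ = L := by simp

include h01 in
lemma expectedRegret_eq :
    expectedRegret P A g.nonempty g.ℓ g.act = g.playerLoss - g.optLoss := by
  have hi : ∀ i n, Integrable (fun ω => (g.arm i).x n ω * (g.arm i).I n ω) P := fun i n =>
    integrable_of_abs_le (((g.arm i).x_meas' n).mul ((g.arm i).I_meas' n)) (C := 1) fun ω => by
      rw [abs_of_nonneg (mul_nonneg ((g.arm i).x_nonneg n ω) ((g.arm i).I_nonneg n ω))]
      exact mul_le_one₀ ((g.arm i).x_le n ω) ((g.arm i).I_nonneg n ω) ((g.arm i).I_le n ω)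
  have hb := fun i n => g.integrable_isBest_mul i n
  have h1 : g.playerLoss = ∫ ω, ∑ i, ∑ n ∈ Finset.range T,
      (g.arm i).x n ω * (g.arm i).I n ω ∂P := by
    rw [integral_finsetSum _ fun i _ => integrable_finsetSum _ fun n _ => hi i n]
    refine Finset.sum_congr rfl fun i _ => ?_
    rw [integral_finsetSum _ fun n _ => hi i n]
    refine Finset.sum_congr rfl fun n _ => ?_
    rw [(g.arm i).integral_mul_I n ((g.arm i).x_meas_G n n) (C := 1) (ae_of_all _ fun ω => by
      rw [abs_of_nonneg ((g.arm i).x_nonneg n ω)]; exact (g.arm i).x_le n ω)]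
    exact integral_congr_ae (ae_of_all _ fun ω => mul_comm _ _)
  have h2 : g.optLoss = ∫ ω, ∑ i, ∑ n ∈ Finset.range T, g.isBest i ω * (g.arm i).x n ω ∂P := by
    rw [integral_finsetSum _ fun i _ => integrable_finsetSum _ fun n _ => hb i n]
    refine Finset.sum_congr rfl fun i _ => ?_
    rw [integral_finsetSum _ fun n _ => hb i n]
  rw [h1, h2, ← integral_sub (integrable_finsetSum _ fun i _ => integrable_finsetSum _
    fun n _ => hi i n) (integrable_finsetSum _ fun i _ => integrable_finsetSum _ fun n _ => hb i n)]
  refine integral_congr_ae ?_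
  filter_upwards [g.sum_cumLoss_eq h01, g.loss_ae_eq h01] with ω h3 h4
  rw [g.sum_isBest_mul, h3]
  congr 1
  rw [Finset.sum_comm, Finset.sum_range]
  refine Finset.sum_congr rfl fun t _ => ?_
  have h5 : ∀ i, (g.arm i).x t ω * (g.arm i).I t ω = if i ∈ g.act t ω then g.ℓ ω t i else 0 := by
    intro i
    have h6 : (g.arm i).x t ω = g.ℓ ω t i := h4 t i
    have h7 : (g.arm i).I t ω = if i ∈ g.act t ω then 1 else 0 := by
      simp [arm, played, Set.indicator_apply]
    rw [h6, h7, mul_ite, mul_one, mul_zero]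
  simp_rw [h5]
  rw [← Finset.sum_filter, Finset.filter_mem_eq_inter, Finset.univ_inter]

lemma playerLoss_sub_optLoss_le (L : ℝ) (K : ℕ) :
    g.playerLoss - g.optLoss ≤ γ * d * g.playerLoss + ∑ k ∈ Finset.range (K + 1), ∑ i,
      ∑ n ∈ Finset.range T, ∫ ω, (g.arm i).N n ω *
        (cleanPart P g (g.binInd L K i k) n ω - g.binInd L K i k ω) * (g.arm i).x n ω ∂P := by
  unfold playerLoss optLoss
  rw [← Finset.sum_sub_distrib, Finset.mul_sum, Finset.sum_comm, ← Finset.sum_add_distrib]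
  refine Finset.sum_le_sum fun i _ => ?_
  rw [← Finset.sum_sub_distrib, Finset.mul_sum, Finset.sum_comm, ← Finset.sum_add_distrib]
  refine Finset.sum_le_sum fun n _ => ?_
  exact g.arm_regret_le (fun k => g.measurable_binInd L K i k) (fun k => g.binInd_nonneg L K i k)
    (fun k => g.binInd_le L K i k) i (g.sum_binInd L K i) n

/-- A non-rare arm has clean posterior above `γ`. This allows `sum_integral_N_le` to be used with
level `γ`. -/
lemma le_condExp_isBest (i : Fin d) (n : ℕ) :
    ∀ᵐ ω ∂P, (g.arm i).N n ω = 1 → γ ≤ (P[g.isBest i | (g.arm i).F n]) ω := by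
  filter_upwards [g.cleanPart_bounds (g.measurable_isBest i) (g.isBest_nonneg i) i
    (fun _ => le_rfl) n, g.condExp_isBest_mul_clean i n] with ω h1 h2 hN
  have hi : i ∉ g.rare n ω := by
    intro hi
    simp [arm, hi] at hN
  have h3 : cleanPart P g (g.isBest i) n ω = cleanProb A (g.law n ω) (g.rare n ω) i := h2
  exact ((lt_cleanProb A _ γ hi).le.trans h3.ge).trans h1.2.1

end Game

/-! ### Numerical estimates and the recursive inequality. -/

section Numerics

lemma log_sq_ge {L : ℝ} (hL : 2 ≤ L) : 0.48 ≤ Real.log L ^ 2 := by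
  have h1 := Real.log_two_gt_d9
  have h2 := Real.log_le_log two_pos hL
  nlinarith

lemma exp_le_three {y : ℝ} (hy : y ≤ 1) : Real.exp y ≤ 3 :=
  (Real.exp_le_exp.2 hy).trans (by linarith [Real.exp_one_lt_d9])

lemma exp_neg_sq_mul_le {L : ℝ} (hL : 0 < L) : Real.exp (-Real.log L ^ 2) * L ≤ 3 := by
  nth_rw 2 [← Real.exp_log hL]
  rw [← Real.exp_add]
  exact exp_le_three (by nlinarith [sq_nonneg (Real.log L - 1)])

/-- With `t = log L`, the exponent `t - t²/2` is at most `1/2`. So the smoothing parameter `ε = exp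
(-t²/2)` is `O(1 / L)`. -/
lemma exp_neg_half_sq_mul_le {L : ℝ} (hL : 0 < L) : Real.exp (-(Real.log L ^ 2 / 2)) * L ≤ 3 := by
  nth_rw 2 [← Real.exp_log hL]
  rw [← Real.exp_add]
  exact exp_le_three (by nlinarith [sq_nonneg (Real.log L - 1)])

lemma clog_add_one_le {m : ℕ} (hm : 1 ≤ m) :
    (2 : ℝ) ^ Nat.clog 2 m ≤ 2 * m ∧ (Nat.clog 2 m : ℝ) + 1 ≤ 2 * (1 + Real.log m) := by
  have hm0 : (0 : ℝ) < m := by exact_mod_cast hm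
  have h1 : (2 : ℝ) ^ Nat.clog 2 m ≤ 2 * m := by
    rcases hm.eq_or_lt with rfl | h
    · simp
    · have h2 := Nat.pow_pred_clog_lt_self one_lt_two h
      have h3 : 0 < Nat.clog 2 m := Nat.clog_pos one_lt_two h
      have h4 : 2 ^ Nat.clog 2 m = 2 * 2 ^ (Nat.clog 2 m).pred := by
        rw [← pow_succ', ← Nat.succ_eq_add_one, Nat.succ_pred_eq_of_pos h3]
      have h5 : 2 ^ Nat.clog 2 m ≤ 2 * m := by omega
      exact_mod_cast h5
  refine ⟨h1, ?_⟩
  have h2 := Real.log_le_log (by positivity) h1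
  rw [Real.log_pow, Real.log_mul two_ne_zero hm0.ne'] at h2
  have h3 := Real.log_two_gt_d9
  have h4 : 0 ≤ Real.log m := Real.log_nonneg (by exact_mod_cast hm)
  by_contra! hc
  nlinarith

lemma one_add_log_le {m : ℝ} (hm : 0 < m) : 1 + Real.log m ≤ 2 * √m := by
  have h1 := Real.log_le_sub_one_of_pos (Real.sqrt_pos.2 hm)
  rw [Real.log_sqrt hm.le] at h1
  linarith

/-- Solve the recursive inequality that the regret satisfies. -/
lemma regret_bound_of_recursion {R S sd sL K lm g D : ℝ} (hsd : 0 ≤ sd) (hsL : 0 < sL)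
    (hlm : 0 ≤ lm) (hg : g ≤ 1 / 2) (hD : 0 ≤ D) (hgD : g * sL ^ 2 = D) (hg0 : 0 ≤ g)
    (hK0 : 0 ≤ K) (hK : K ≤ 2 * (1 + lm)) (hKd : K * sd ≤ 5 * sL) (hS : S ≤ R + sL ^ 2)
    (hR : R ≤ g * S + K * (333 * (sd * sL) + sd / (20 * sL) * S)) :
    R ≤ 3000 * ((1 + lm) * (sd * sL) + D) := by
  have hnn : 0 ≤ (1 + lm) * (sd * sL) := by positivity
  rcases le_or_gt R 0 with h | h
  · exact h.trans (by positivity)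
  -- As `S ≤ R + sL²` and `R > 0`, the terms in `R` on the right amount to at most `R/2 + R/4`.
  -- Absorbing them costs a factor 4, and `4 * 2 * 333.05 ≤ 3000`.
  have h1 : g * S ≤ R / 2 + D := by
    calc g * S ≤ g * (R + sL ^ 2) := by gcongr
      _ = g * R + D := by rw [← hgD]; ring
      _ ≤ _ := by nlinarith
  have h2 : sd / (20 * sL) * S ≤ sd / (20 * sL) * R + sd * sL / 20 := by
    calc sd / (20 * sL) * S ≤ sd / (20 * sL) * (R + sL ^ 2) := by gcongr
      _ = _ := by field_simp
  have h3 : K * (sd / (20 * sL) * R) ≤ R / 4 := by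
    have h4 : K * (sd / (20 * sL) * R) = K * sd / (20 * sL) * R := by ring
    have h5 : K * sd / (20 * sL) ≤ 1 / 4 := by
      rw [div_le_iff₀ (by positivity)]; linarith
    rw [h4]
    nlinarith
  have h6 : K * (sd * sL) ≤ 2 * (1 + lm) * (sd * sL) := by gcongr
  have h7 : K * (333 * (sd * sL) + sd / (20 * sL) * S) ≤
      K * (333 * (sd * sL) + (sd / (20 * sL) * R + sd * sL / 20)) := by gcongr
  nlinarith

end Numerics

/-! ### Choice of parameters and conclusion. -/

namespace Game

variable {Ω : Type*} [mΩ : MeasurableSpace Ω] {P : Measure Ω} {T d : ℕ}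
  {A : Finset (Finset (Fin d))} {γ : ℝ} (g : Game P T d A γ) [IsProbabilityMeasure P]
  {L : ℝ} {m : ℕ}

/-- The loss of one arm while its loss may still lie in the `k`-th bin. -/
lemma sum_integral_likely_binInd_le (hL : 2 ≤ L) (hm : 1 ≤ m)
    (hγ : γ = m * Real.log L ^ 2 / L) (h01 : ∀ᵐ ω ∂P, ∀ t i, g.ℓ ω t i ∈ Set.Icc (0 : ℝ) 1)
    (hbest : ∀ᵐ ω ∂P, bestLoss A g.nonempty (g.ℓ ω) ≤ L) (K : ℕ) (i : Fin d) {k : ℕ}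
    (hk : (2 : ℝ) ^ k ≤ 2 * m) :
    ∑ n ∈ Finset.range T, ∫ ω, (g.arm i).N n ω * (g.arm i).x n ω *
      (g.arm i).likely (g.binInd L K i k) (Real.exp (-(Real.log L ^ 2 / 2))) n ω ∂P
      ≤ 18 * (L / 2 ^ k) := by
  have hL0 : 0 < L := by linarith
  have hm0 : (1 : ℝ) ≤ m := by exact_mod_cast hm
  have hΛ := log_sq_ge hL
  have h2k : (0 : ℝ) < 2 ^ k := by positivity
  set ε := Real.exp (-(Real.log L ^ 2 / 2)) with hε
  refine ((g.arm i).sum_integral_likely_le g.γ_pos (g.measurable_binInd_full L K i k)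
    (g.binInd_nonneg L K i k) (g.binInd_le L K i k) (Real.exp_pos _) (B := L / 2 ^ k)
    (by positivity) T (g.cumLoss_le_of_binInd h01 hbest K i k)).trans ?_
  have h1 : 1 / γ ≤ 5 * (L / 2 ^ k) := by
    rw [hγ, one_div_div, mul_div_assoc', div_le_div_iff₀ (by positivity) h2k]
    have : (2 : ℝ) ^ k ≤ 5 * (m * Real.log L ^ 2) := by nlinarith
    nlinarith
  -- The choice of `γ` is made for this: the factor `m` compensates `2^k ≤ 2m`, so `γ * B ≥ log² L /
  -- 2` in every bin and the failure probability cancels `1 / ε`.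
  have h2 : Real.exp (-(γ * (L / 2 ^ k))) ≤ ε := by
    refine Real.exp_le_exp.2 (neg_le_neg ?_)
    have h3 : γ * (L / 2 ^ k) = m / 2 ^ k * Real.log L ^ 2 := by rw [hγ]; field_simp
    have h4 : (1 : ℝ) / 2 ≤ m / 2 ^ k := by
      rw [div_le_div_iff₀ two_pos h2k]; linarith
    rw [h3]
    nlinarith
  have h3 : Real.exp (-(γ * (L / 2 ^ k))) / (ε * γ) ≤ 1 / γ := by
    have hγ0 := g.γ_pos
    have hε0 : 0 < ε := Real.exp_pos _
    rw [div_le_div_iff₀ (by positivity) hγ0]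
    nlinarith
  linarith

/-- The total loss of an arm while it is not rare. -/
lemma mul_sum_integral_N_le (hL : 2 ≤ L) (hm : 1 ≤ m)
    (hγ : γ = m * Real.log L ^ 2 / L) (h01 : ∀ᵐ ω ∂P, ∀ t i, g.ℓ ω t i ∈ Set.Icc (0 : ℝ) 1)
    (hbest : ∀ᵐ ω ∂P, bestLoss A g.nonempty (g.ℓ ω) ≤ L) (i : Fin d) :
    Real.exp (-(Real.log L ^ 2 / 2)) *
      ∑ n ∈ Finset.range T, ∫ ω, (g.arm i).N n ω * (g.arm i).x n ω ∂P ≤ 96 := by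
  have hL0 : 0 < L := by linarith
  have hm0 : (1 : ℝ) ≤ m := by exact_mod_cast hm
  have hΛ := log_sq_ge hL
  -- Here the event is membership in `a*` itself, with `B = L` and level `γ`. The resulting bound
  -- `O(L)` is harmless after multiplication by `ε`.
  have h0 := (g.arm i).sum_integral_N_le g.γ_pos (g.measurable_isBest_full i)
    (g.isBest_nonneg i) (g.isBest_le i) g.γ_pos (B := L) hL0.le T
    (g.cumLoss_le_of_isBest h01 hbest i) (g.le_condExp_isBest i)
  have hmΛ : 0.48 ≤ m * Real.log L ^ 2 := by nlinarith
  have h1 : 1 / γ ≤ 2.1 * L := by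
    rw [hγ, one_div_div, div_le_iff₀ (by linarith)]
    nlinarith
  have h1' : 0 < 1 / γ := one_div_pos.2 g.γ_pos
  have h2 : Real.exp (-(γ * L)) * L ≤ 3 := by
    refine le_trans ?_ (exp_neg_sq_mul_le hL0)
    gcongr
    rw [hγ, div_mul_cancel₀ _ hL0.ne']
    nlinarith
  have h3 : Real.exp (-(γ * L)) / (γ * γ) ≤ 13.23 * L := by
    have h4 : Real.exp (-(γ * L)) / (γ * γ) = Real.exp (-(γ * L)) * (1 / γ) * (1 / γ) := by
      field_simp
    rw [h4]
    have h5 : Real.exp (-(γ * L)) * (1 / γ) ≤ Real.exp (-(γ * L)) * (2.1 * L) := by gcongr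
    have h6 : Real.exp (-(γ * L)) * (1 / γ) ≤ 6.3 := by linarith
    calc _ ≤ 6.3 * (2.1 * L) := by gcongr
      _ = _ := by ring
  have h7 : ∑ n ∈ Finset.range T, ∫ ω, (g.arm i).N n ω * (g.arm i).x n ω ∂P ≤ 32 * L := by
    linarith
  calc _ ≤ Real.exp (-(Real.log L ^ 2 / 2)) * (32 * L) := by gcongr
    _ = 32 * (Real.exp (-(Real.log L ^ 2 / 2)) * L) := by ring
    _ ≤ 32 * 3 := by gcongr; exact exp_neg_half_sq_mul_le hL0
    _ = 96 := by norm_num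

/-- The regret attributed to one bin. -/
lemma bin_regret_le (hL : 2 ≤ L) (hm : 1 ≤ m) (hAm : ∀ a ∈ A, a.card = m)
    (hγ : γ = m * Real.log L ^ 2 / L) (hd : 0 < d) (hdL : (d : ℝ) ≤ 1.05 * L)
    (h01 : ∀ᵐ ω ∂P, ∀ t i, g.ℓ ω t i ∈ Set.Icc (0 : ℝ) 1)
    (hbest : ∀ᵐ ω ∂P, bestLoss A g.nonempty (g.ℓ ω) ≤ L) {K : ℕ} (hK : m ≤ 2 ^ K)
    (hK2 : (2 : ℝ) ^ K ≤ 2 * m) {k : ℕ} (hk : k ≤ K) :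
    ∑ i, ∑ n ∈ Finset.range T, ∫ ω, (g.arm i).N n ω *
        (cleanPart P g (g.binInd L K i k) n ω - g.binInd L K i k ω) * (g.arm i).x n ω ∂P ≤
      333 * (√d * √L) + √d / (20 * √L) * g.playerLoss := by
  have hL0 : 0 < L := by linarith
  have hd0 : (0 : ℝ) < d := by exact_mod_cast hd
  have h2k : (0 : ℝ) < 2 ^ k := by positivity
  set ε := Real.exp (-(Real.log L ^ 2 / 2)) with hε
  have hε0 : 0 < ε := Real.exp_pos _
  set sd := √(d : ℝ) with hsd
  set sL := √L with hsL
  set b := √((2 : ℝ) ^ k) with hb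
  have hsd0 : 0 < sd := Real.sqrt_pos.2 hd0
  have hsL0 : 0 < sL := Real.sqrt_pos.2 hL0
  have hb0 : 0 < b := Real.sqrt_pos.2 h2k
  have hsd2 : sd ^ 2 = d := Real.sq_sqrt hd0.le
  have hsL2 : sL ^ 2 = L := Real.sq_sqrt hL0.le
  have hb2 : b ^ 2 = 2 ^ k := Real.sq_sqrt h2k.le
  have hkm : (2 : ℝ) ^ k ≤ 2 * m :=
    (pow_le_pow_right₀ one_le_two hk).trans hK2
  -- The parameters are `η = 5 √(L / 2^k)` and `ρ = √(d / 2^k)`. They make both error terms of order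
  -- `√(d L)`, and the 5 makes the coefficient of the player's loss small enough to be absorbed.
  have hη : 0 < 5 * sL / b := by positivity
  have hρ : 0 < sd / b := by positivity
  -- Cauchy-Schwarz, as AM-GM at the common value `b / sd`. The bin probabilities sum to at most
  -- `2b²` and `d * ε ≤ 4b²`, whence `(6 + 1) / 2`.
  have hprob : ∑ i, √(∫ ω, g.binInd L K i k ω ∂P + ε) ≤ 3.5 * (sd * b) := by
    have h1 : ∀ i, √(∫ ω, g.binInd L K i k ω ∂P + ε) ≤
        ((∫ ω, g.binInd L K i k ω ∂P + ε) * (sd / b) + b / sd) / 2 := fun i => by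
      have h2 : 0 ≤ ∫ ω, g.binInd L K i k ω ∂P := integral_nonneg (g.binInd_nonneg L K i k)
      refine (sqrt_le_half_div_add (by linarith) (s := b / sd) (by positivity)).trans ?_
      rw [div_div_eq_mul_div, mul_div_assoc]
    refine (Finset.sum_le_sum fun i _ => h1 i).trans ?_
    rw [← Finset.sum_div, Finset.sum_add_distrib, ← Finset.sum_mul, Finset.sum_add_distrib]
    simp only [Finset.sum_const, Finset.card_univ, Fintype.card_fin, nsmul_eq_mul]
    have h3 := g.sum_integral_binInd_le hL0 h01 hbest hAm hK hk
    have h4 : (d : ℝ) * ε ≤ 4 * b ^ 2 := by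
      have h5 := exp_neg_half_sq_mul_le hL0
      have h6 : (1 : ℝ) ≤ 2 ^ k := one_le_pow₀ one_le_two
      rw [hb2]
      nlinarith
    have h7 : ∑ i, ∫ ω, g.binInd L K i k ω ∂P + d * ε ≤ 6 * b ^ 2 := by
      rw [pow_succ, ← hb2] at h3
      linarith
    have h8 : (∑ i, ∫ ω, g.binInd L K i k ω ∂P + d * ε) * (sd / b) ≤ 6 * b ^ 2 * (sd / b) := by
      gcongr
    have h9 : 6 * b ^ 2 * (sd / b) = 6 * (sd * b) := by field_simp
    have h10 : (d : ℝ) * (b / sd) = sd * b := by rw [← hsd2]; field_simp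
    linarith
  have hstep := Finset.sum_le_sum fun (i : Fin d) (_ : i ∈ Finset.univ) =>
    (g.arm i).sum_integral_regret_le g.γ_pos (g.measurable_binInd_full L K i k)
      (g.binInd_nonneg L K i k) (g.binInd_le L K i k) hε0 hη hρ
      (c := fun n => cleanPart P g (g.binInd L K i k) n)
      (fun n => measurable_condExp_self)
      (fun n => g.cleanPart_bounds (g.measurable_binInd L K i k) (g.binInd_nonneg L K i k) i
        (g.binInd_le_isBest L K i k) n) T
  -- The constant is `333 = 192 + 140 + 1`, from `e1`, `e2` and `e4`.
  refine hstep.trans ?_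
  rw [Finset.sum_add_distrib, Finset.sum_add_distrib, ← Finset.mul_sum, ← Finset.mul_sum,
    ← Finset.mul_sum, Finset.sum_add_distrib, ← Finset.mul_sum, ← Finset.sum_div]
  have e1 : ε * ∑ i : Fin d, ∑ n ∈ Finset.range T,
      ∫ ω, (g.arm i).N n ω * (g.arm i).x n ω ∂P ≤ 192 * (sd * sL) := by
    rw [Finset.mul_sum]
    calc _ ≤ ∑ _i : Fin d, (96 : ℝ) :=
          Finset.sum_le_sum fun i _ => g.mul_sum_integral_N_le hL hm hγ h01 hbest i
      _ = d * 96 := by simp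
      _ ≤ _ := by
          have : sd ≤ 2 * sL := by nlinarith
          rw [← hsd2]
          nlinarith
  have e2 : 8 * (5 * sL / b) * ∑ i, √(∫ ω, g.binInd L K i k ω ∂P + ε) ≤ 140 * (sd * sL) := by
    calc _ ≤ 8 * (5 * sL / b) * (3.5 * (sd * b)) := by gcongr
      _ = _ := by field_simp; norm_num
  have e3 : ∑ i : Fin d, ∑ n ∈ Finset.range T, ∫ ω, (g.arm i).N n ω * (g.arm i).x n ω *
      (g.arm i).likely (g.binInd L K i k) ε n ω ∂P ≤ d * (18 * (L / 2 ^ k)) := by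
    calc _ ≤ ∑ _i : Fin d, 18 * (L / 2 ^ k) := Finset.sum_le_sum fun i _ =>
          g.sum_integral_likely_binInd_le hL hm hγ h01 hbest K i hkm
      _ = _ := by simp
  have e4 : 1 / (4 * (5 * sL / b)) * (sd / b * g.playerLoss + (∑ i : Fin d,
      ∑ n ∈ Finset.range T, ∫ ω, (g.arm i).N n ω * (g.arm i).x n ω *
      (g.arm i).likely (g.binInd L K i k) ε n ω ∂P) / (sd / b)) ≤
      sd / (20 * sL) * g.playerLoss + sd * sL := by
    calc _ ≤ 1 / (4 * (5 * sL / b)) * (sd / b * g.playerLoss +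
          d * (18 * (L / 2 ^ k)) / (sd / b)) := by gcongr
      _ = sd / (20 * sL) * g.playerLoss + 0.9 * (sd * sL) := by
          rw [← hsd2, ← hsL2, ← hb2]
          field_simp
          ring
      _ ≤ _ := by nlinarith [mul_pos hsd0 hsL0]
  unfold playerLoss at e4 ⊢
  linarith

/-- First-order regret bound for a game played by thresholded Thompson Sampling. -/
lemma expectedRegret_le (hL : 2 ≤ L) (hm : 1 ≤ m) (hAm : ∀ a ∈ A, a.card = m)
    (hγ : γ = m * Real.log L ^ 2 / L) (hd : 0 < d)
    (h01 : ∀ᵐ ω ∂P, ∀ t i, g.ℓ ω t i ∈ Set.Icc (0 : ℝ) 1)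
    (hbest : ∀ᵐ ω ∂P, bestLoss A g.nonempty (g.ℓ ω) ≤ L) :
    expectedRegret P A g.nonempty g.ℓ g.act ≤
      3000 * ((1 + Real.log m) * √(d * L) + m * d * Real.log L ^ 2) := by
  have hL0 : 0 < L := by linarith
  have hd0 : (0 : ℝ) < d := by exact_mod_cast hd
  have hm0 : (1 : ℝ) ≤ m := by exact_mod_cast hm
  have hΛ := log_sq_ge hL
  have hγL : γ * L = m * Real.log L ^ 2 := by rw [hγ, div_mul_cancel₀ _ hL0.ne']
  -- The condition `γ * d ≤ 1/2` says that `m * d * log² L ≤ L / 2`, and `log² L ≥ 0.48`.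
  have hmd : (m : ℝ) * d ≤ 1.05 * L := by
    have h1 : m * Real.log L ^ 2 * d ≤ L / 2 := by
      rw [← hγL]
      nlinarith [g.γ_le]
    nlinarith [mul_pos (zero_lt_one.trans_le hm0) hd0]
  have hdL : (d : ℝ) ≤ 1.05 * L := by nlinarith
  obtain ⟨hK2, hK1⟩ := clog_add_one_le hm
  have hK : m ≤ 2 ^ Nat.clog 2 m := Nat.le_pow_clog one_lt_two m
  set K := Nat.clog 2 m
  have hdec := g.playerLoss_sub_optLoss_le L K
  have hbins : ∑ k ∈ Finset.range (K + 1), ∑ i, ∑ n ∈ Finset.range T, ∫ ω, (g.arm i).N n ω *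
      (cleanPart P g (g.binInd L K i k) n ω - g.binInd L K i k ω) * (g.arm i).x n ω ∂P ≤
      (K + 1) * (333 * (√d * √L) + √d / (20 * √L) * g.playerLoss) := by
    calc _ ≤ ∑ _k ∈ Finset.range (K + 1),
          (333 * (√d * √L) + √d / (20 * √L) * g.playerLoss) :=
          Finset.sum_le_sum fun k hk => g.bin_regret_le hL hm hAm hγ hd hdL h01 hbest hK hK2
            (Finset.mem_range_succ_iff.1 hk)
      _ = _ := by
          rw [Finset.sum_const, Finset.card_range, nsmul_eq_mul]
          push_cast
          rfl
  have hopt := g.optLoss_le h01 hbest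
  rw [g.expectedRegret_eq h01, Real.sqrt_mul hd0.le]
  have hsL2 : √L ^ 2 = L := Real.sq_sqrt hL0.le
  refine regret_bound_of_recursion (K := K + 1) (S := g.playerLoss) (g := γ * d)
    (Real.sqrt_nonneg _) (Real.sqrt_pos.2 hL0) (Real.log_nonneg hm0) g.γ_le (by positivity)
    ?_ (mul_nonneg g.γ_pos.le hd0.le) (by positivity) hK1 ?_ ?_ (by linarith)
  · rw [hsL2, mul_right_comm, hγL]; ring
  -- Absorption requires `(K + 1) √d ≤ 5 √L`: the logarithm is at most of order `√m`, and `m * d =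
  -- O(L)`.
  · have h1 := one_add_log_le (zero_lt_one.trans_le hm0)
    have h2 : √(m : ℝ) * √(d : ℝ) ≤ 1.25 * √L := by
      rw [← Real.sqrt_mul (by positivity)]
      refine Real.sqrt_le_iff.2 ⟨by positivity, ?_⟩
      rw [mul_pow, hsL2]
      linarith
    calc ((K : ℝ) + 1) * √d ≤ 4 * √m * √d := by
          have := Real.sqrt_nonneg (d : ℝ)
          gcongr
          linarith
      _ = 4 * (√m * √d) := by ring
      _ ≤ _ := by linarith
  · rw [hsL2]; linarith

end Game

end SemiBandit

end

theorem mainTheorem11 :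
    ∃ C : ℝ, 0 < C ∧
      ∀ (d m T : ℕ) (_hm : 1 ≤ m)
        (A : Finset (Finset (Fin d))) (hA : A.Nonempty) (_hAm : ∀ a ∈ A, a.card = m)
        (Lbar γ : ℝ) (_hL : 2 ≤ Lbar)
        (_hγ : γ = m * Real.log Lbar ^ 2 / Lbar) (_hγd : γ ≤ 1 / (2 * d))
        (Ω : Type*) [MeasurableSpace Ω] (P : Measure Ω) [IsProbabilityMeasure P]
        (ℓ : Ω → Fin T → Fin d → ℝ) (_hℓ : Measurable ℓ)
        (_hℓ01 : ∀ᵐ ω ∂P, ∀ t i, ℓ ω t i ∈ Set.Icc (0 : ℝ) 1)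
        (_hbest : ∀ᵐ ω ∂P, SemiBandit.bestLoss A hA (ℓ ω) ≤ Lbar)
        (astar : (Fin T → Fin d → ℝ) → Finset (Fin d))
        (_hastar : SemiBandit.IsOptimalAction A astar)
        (act : Fin T → Ω → Finset (Fin d))
        (_hact : SemiBandit.IsThresholdedThompsonSampling P A γ ℓ astar act),
        SemiBandit.expectedRegret P A hA ℓ act ≤
          C * ((1 + Real.log m) * Real.sqrt (d * Lbar) + m * d * Real.log Lbar ^ 2) := by
  refine ⟨3000, by norm_num, ?_⟩
  intro d m T hm A hA hAm L γ hL hγ hγd Ω _ P _ ℓ hℓ hℓ01 hbest astar hastar act hact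
  obtain ⟨a, ha⟩ := hA
  -- An action of size `m ≥ 1` exists, so `d > 0` and `1 / (2 * d)` is a genuine quotient.
  have hd : 0 < d := by
    have h1 := Finset.card_le_univ a
    rw [hAm a ha, Fintype.card_fin] at h1
    omega
  have hd0 : (0 : ℝ) < d := by exact_mod_cast hd
  have hm0 : (1 : ℝ) ≤ m := by exact_mod_cast hm
  have hΛ := SemiBandit.log_sq_ge hL
  have hγ0 : 0 < γ := by
    rw [hγ]
    have hL0 : 0 < L := by linarith
    positivity
  have hγ1 : γ * d ≤ 1 / 2 := by
    calc γ * d ≤ 1 / (2 * d) * d := by gcongr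
      _ = 1 / 2 := by field_simp
  let g : SemiBandit.Game P T d A γ := ⟨ℓ, astar, act, hℓ, hastar, hact, ⟨a, ha⟩, hγ0, hγ1⟩
  exact g.expectedRegret_le hL hm hAm hγ hd hℓ01 hbest
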